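/- Let $\Omega\subset\mathbb R^n$ be a bounded domain (a nonempty, open, connected set), and let $\Sigma\subset\partial\Omega$ be a nonempty, connected, relatively open subset of $\partial\Omega$ that is Lipschitz, in the sense that near each point of $\Sigma$ the set $\Omega$ is, in suitable Cartesian coordinates, the set of points lying strictly above the graph of a Lipschitz function. Put $\Sigma^c:=\partial\Omega\setminus\overline{\Sigma}$ and $$H^2_{0,\Sigma^c}(\Omega):=\{v\in C^\infty(\Omega)\cap H^2(\Omega)\colon \operatorname{supp}v\cap\Sigma^c=\emptyset\},$$ where $\operatorname{supp}v$ is the closure in $\mathbb R^n$ of $\{x\in\Omega\colon v(x)\neq0\}$. For real-valued $z\in L_2(\Omega)$ define the functional $Bz$ on this space by $$(Bz)(v):=-\int_\Omega z\,\Delta v\,dx,\qquad \|Bz\|_{(H^2_{0,\Sigma^c}(\Omega))'}:=\sup_{0\neq v\in H^2_{0,\Sigma^c}(\Omega)}\frac{|(Bz)(v)|}{\|v\|_{H^2(\Omega)}}.$$ Let $G\subset\Omega$ be a domain that has a positive distance to $\Sigma^c$ (a condition that is void if $\Sigma^c=\emptyset$). Then there exist $\alpha\in(0,1)$ and a constant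 $C\ge 0$, depending only on $\Omega$, $\Sigma$ and $G$, such that for all $z\in L_2(\Omega)$ $$\|z\|_{L_2(G)}\le C\,\|Bz\|^{\alpha}_{(H^2_{0,\Sigma^c}(\Omega))'}\bigl(\|z\|_{L_2(\Omega)}+\|Bz\|_{(H^2_{0,\Sigma^c}(\Omega))'}\bigr)^{1-\alpha}.$$ -/

import Mathlib

open MeasureTheory Set
open scoped ENNReal NNReal ContDiff

noncomputable section

namespace CauchyStability

/-- `ℝⁿ` with the Euclidean norm and Lebesgue measure. -/
abbrev E (n : ℕ) : Type := EuclideanSpace ℝ (Fin n)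

variable {n : ℕ}

/-- The partial derivative `∂ᵢ v`. -/
def pd (i : Fin n) (v : E n → ℝ) : E n → ℝ :=
  fun x => fderiv ℝ v x (EuclideanSpace.single i 1)

/-- The `L₂(S)`-norm, with values in `[0,∞]`. -/
def normL2 (S : Set (E n)) (v : E n → ℝ) : ℝ≥0∞ :=
  eLpNorm v 2 (volume.restrict S)

/-- The `H²(Ω)`-norm (with values in `[0,∞]`) of a function that is smooth on the open set `Ω`:
`‖v‖² = ‖v‖²_{L₂(Ω)} + ∑ᵢ ‖∂ᵢ v‖²_{L₂(Ω)} + ∑ᵢⱼ ‖∂ᵢ ∂ⱼ v‖²_{L₂(Ω)}`.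
For smooth functions the weak derivatives are the classical ones. -/
def normH2 (Ω : Set (E n)) (v : E n → ℝ) : ℝ≥0∞ :=
  (normL2 Ω v ^ 2 + ∑ i, normL2 Ω (pd i v) ^ 2
    + ∑ i, ∑ j, normL2 Ω (pd i (pd j v)) ^ 2) ^ (1 / 2 : ℝ)

/-- `Ω` is a Lipschitz domain near its boundary point `x`: in a suitable direction `e`, and within
a ball around `x`, it is the set of points strictly above the graph of a Lipschitz function on the
hyperplane `eᗮ`. -/
def IsLipschitzNear (Ω : Set (E n)) (x : E n) : Prop :=
  ∃ e : E n, ‖e‖ = 1 ∧ ∃ (K : ℝ≥0) (φ : (Submodule.span ℝ {e})ᗮ → ℝ), LipschitzWith K φ ∧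
    ∃ r : ℝ, 0 < r ∧ x ∈ frontier Ω ∧ ∀ y ∈ Metric.ball x r,
      (y ∈ Ω ↔ φ ((Submodule.span ℝ {e})ᗮ.orthogonalProjectionOnto y) < inner ℝ e y)

/-- `S` is a relatively open, Lipschitz part of the boundary of `Ω`. -/
structure IsOpenLipschitzBoundaryPart (Ω S : Set (E n)) : Prop where
  relOpen : ∃ U : Set (E n), IsOpen U ∧ S = U ∩ frontier Ω
  lipschitz : ∀ x ∈ S, IsLipschitzNear Ω x

/-- `Sᶜ := ∂Ω \ closure S`. -/
def boundaryCompl (Ω S : Set (E n)) : Set (E n) := frontier Ω \ closure S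

/-- The space `{v ∈ C^∞(Ω) ∩ H²(Ω) : supp v ∩ Sᶜ = ∅}`, where `supp v` is the closure in `ℝⁿ` of
`{x ∈ Ω : v x ≠ 0}`. Only the values of `v` on `Ω` matter. -/
def testSpace (Ω S : Set (E n)) : Set (E n → ℝ) :=
  {v | ContDiffOn ℝ ∞ v Ω ∧ normH2 Ω v < ⊤ ∧
    closure {x ∈ Ω | v x ≠ 0} ∩ boundaryCompl Ω S = ∅}

/-- `(B z)(v) = -∫_Ω z Δv`. -/
def B (Ω : Set (E n)) (z v : E n → ℝ) : ℝ :=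
  -∫ x in Ω, z x * Laplacian.laplacian v x

/-- The dual norm of `B z`: the supremum of `|(B z)(v)| / ‖v‖_{H²(Ω)}` over all nonzero `v` in the
test space. -/
def dualNormB (Ω S : Set (E n)) (z : E n → ℝ) : ℝ≥0∞ :=
  ⨆ v ∈ testSpace Ω S, ⨆ _ : normH2 Ω v ≠ 0, ‖B Ω z v‖ₑ / normH2 Ω v

end CauchyStability

end

noncomputable section

namespace CauchyStability

variable {n : ℕ}

/-! Membership of a test function in $H^2_{0,\Sigma^c}$ leaves its values near $\Sigma$ free, so
smallness of $Bz$ says that the extension of $z$ by zero is almost harmonic even across $\Sigma$.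
Let $W$ be $\Omega$ together with a thin neighbourhood of $G$ and of one point $x_0\in\Sigma$. It is
open, connected, bounded and disjoint from $\Sigma^c$. For $v\in C_c^\infty(W)$ the $H^2$-norm is
bounded by $\|\Delta v\|_{L_2}$ (`integral_sobolev_le`), hence $|\int z\,\Delta v|\le
c\,\|Bz\|\,\|\Delta v\|$.

Projecting the extended $z$ orthogonally onto the closure of $\Delta C_c^\infty(W)$ in $L_2(\mathbb
R^n)$ writes it as $w+h$ with $\|w\|\le c\,\|Bz\|$ and $h$ weakly harmonic on $W$
(`exists_weaklyHarmonic_decomposition`). The Lipschitz condition at $x_0$ supplies a ball in $W$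
outside $\Omega$. There $z$ is extended by $0$, so $h=-w$ is small on it.

It remains to propagate smallness of $h$ from that ball to the compact set $\overline G\subset W$.
Iterating a weighted Caccioppoli inequality (`caccioppoli`) gives $L_2$-bounds of analytic type,
$k!\,a^k$, on directional derivatives. Taylor expansion along a short vector then carries smallness
from one ball to the next (`l2norm_propagation`), and connectedness of $W$ and compactness of
$\overline G$ finish (`exists_controls_isCompact`). All estimates keep a free parameter $t\in(0,1]$,
and optimising over it at the end (`le_rpow_of_forall_interpolation`) yields the Hölder exponent. -/

/-! ### Directional derivatives and the Laplacian of smooth functions -/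

/-- The derivative of `u` along the vector `e`. -/
def dirDeriv (e : E n) (u : E n → ℝ) : E n → ℝ := fun x => fderiv ℝ u x e

theorem pd_eq_dirDeriv (i : Fin n) (u : E n → ℝ) :
    pd i u = dirDeriv (EuclideanSpace.single i 1) u := rfl

theorem contDiff_dirDeriv {u : E n → ℝ} (hu : ContDiff ℝ ∞ u) (e : E n) :
    ContDiff ℝ ∞ (dirDeriv e u) :=
  (hu.fderiv_right (m := ∞) (by simp)).clm_apply contDiff_const

theorem contDiff_pd {u : E n → ℝ} (hu : ContDiff ℝ ∞ u) (i : Fin n) :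
    ContDiff ℝ ∞ (pd i u) := contDiff_dirDeriv hu _

theorem fderiv_dirDeriv {u : E n → ℝ} {x : E n} (hu : ContDiffAt ℝ 2 u x) (e f : E n) :
    fderiv ℝ (dirDeriv e u) x f = fderiv ℝ (fderiv ℝ u) x f e := by
  have h : DifferentiableAt ℝ (fderiv ℝ u) x :=
    (hu.fderiv_right (m := 1) (by norm_num)).differentiableAt (by norm_num)
  have := h.hasFDerivAt.clm_apply (hasFDerivAt_const e x)
  unfold dirDeriv
  rw [this.fderiv]
  simp

theorem dirDeriv_comm {u : E n → ℝ} (hu : ContDiff ℝ ∞ u) (e f : E n) :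
    dirDeriv e (dirDeriv f u) = dirDeriv f (dirDeriv e u) := by
  ext x
  have h2 : ContDiffAt ℝ 2 u x := (contDiff_infty.1 hu 2).contDiffAt
  change fderiv ℝ (dirDeriv f u) x e = fderiv ℝ (dirDeriv e u) x f
  rw [fderiv_dirDeriv h2, fderiv_dirDeriv h2]
  exact (h2.isSymmSndFDerivAt (by simp)) e f

theorem laplacian_eq_sum_pd {v : E n → ℝ} {x : E n} (hv : ContDiffAt ℝ 2 v x) :
    Laplacian.laplacian v x = ∑ i, pd i (pd i v) x := by
  rw [InnerProductSpace.laplacian_eq_iteratedFDeriv_orthonormalBasis v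
    (EuclideanSpace.basisFun (Fin n) ℝ)]
  refine Finset.sum_congr rfl fun i _ => ?_
  rw [iteratedFDeriv_two_apply]
  simp only [EuclideanSpace.basisFun_apply]
  exact (fderiv_dirDeriv hv _ _).symm

/-- The Laplacian of a smooth function as the sum of its pure second partial derivatives. -/
def lap (u : E n → ℝ) : E n → ℝ := fun x => ∑ i, pd i (pd i u) x

theorem laplacian_eq_lap {v : E n → ℝ} (hv : ContDiff ℝ ∞ v) :
    Laplacian.laplacian v = lap v :=
  funext fun _ => laplacian_eq_sum_pd (contDiff_infty.1 hv 2).contDiffAt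

theorem contDiff_lap {u : E n → ℝ} (hu : ContDiff ℝ ∞ u) : ContDiff ℝ ∞ (lap u) :=
  ContDiff.sum fun i _ => contDiff_pd (contDiff_pd hu i) i

theorem lap_dirDeriv {u : E n → ℝ} (hu : ContDiff ℝ ∞ u) (e : E n) :
    lap (dirDeriv e u) = dirDeriv e (lap u) := by
  ext x
  have h : ∀ i, DifferentiableAt ℝ (pd i (pd i u)) x := fun i =>
    (contDiff_pd (contDiff_pd hu i) i).differentiable (by simp) x
  have h1 : dirDeriv e (lap u) x = ∑ i, dirDeriv e (pd i (pd i u)) x := by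
    unfold dirDeriv lap
    rw [fderiv_fun_sum (fun i _ => h i)]
    simp
  rw [h1]
  refine Finset.sum_congr rfl fun i _ => ?_
  simp only [pd_eq_dirDeriv]
  rw [dirDeriv_comm hu _ e, dirDeriv_comm (contDiff_dirDeriv hu _) _ e]

theorem lap_dirDeriv_eq_zero {u : E n → ℝ} (hu : ContDiff ℝ ∞ u) (e : E n) {V : Set (E n)}
    (hV : IsOpen V) (h : ∀ x ∈ V, lap u x = 0) : ∀ x ∈ V, lap (dirDeriv e u) x = 0 := by
  intro x hx
  rw [lap_dirDeriv hu]
  have : lap u =ᶠ[nhds x] fun _ => 0 := by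
    filter_upwards [hV.mem_nhds hx] with y hy using h y hy
  simp [dirDeriv, this.fderiv_eq]

theorem contDiff_iterate_dirDeriv {u : E n → ℝ} (hu : ContDiff ℝ ∞ u) (e : E n) (k : ℕ) :
    ContDiff ℝ ∞ ((dirDeriv e)^[k] u) := by
  induction k with
  | zero => exact hu
  | succ k ih => rw [Function.iterate_succ_apply']; exact contDiff_dirDeriv ih e

theorem lap_iterate_dirDeriv_eq_zero {u : E n → ℝ} (hu : ContDiff ℝ ∞ u) (e : E n)
    {V : Set (E n)} (hV : IsOpen V) (h : ∀ x ∈ V, lap u x = 0) (k : ℕ) :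
    ∀ x ∈ V, lap ((dirDeriv e)^[k] u) x = 0 := by
  induction k with
  | zero => exact h
  | succ k ih =>
    rw [Function.iterate_succ_apply']
    exact lap_dirDeriv_eq_zero (contDiff_iterate_dirDeriv hu e k) e hV ih

theorem hasCompactSupport_dirDeriv {u : E n → ℝ} (hu : HasCompactSupport u) (e : E n) :
    HasCompactSupport (dirDeriv e u) :=
  hu.fderiv_apply (𝕜 := ℝ) e

theorem hasCompactSupport_pd {u : E n → ℝ} (hu : HasCompactSupport u) (i : Fin n) :
    HasCompactSupport (pd i u) := hasCompactSupport_dirDeriv hu _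

theorem hasCompactSupport_lap {u : E n → ℝ} (hu : HasCompactSupport u) :
    HasCompactSupport (lap u) := by
  have h : ∀ s : Finset (Fin n), HasCompactSupport (fun x => ∑ i ∈ s, pd i (pd i u) x) := by
    intro s
    induction s using Finset.induction_on with
    | empty =>
      simp only [Finset.sum_empty]
      exact (HasCompactSupport.zero : HasCompactSupport (0 : E n → ℝ))
    | insert a s ha ih =>
      simp only [Finset.sum_insert ha]
      exact (hasCompactSupport_pd (hasCompactSupport_pd hu a) a).add ih
  exact h Finset.univ

/-! ### Integration by parts and control of the H²-norm by the Laplacian -/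

/-- Integration by parts against a compactly supported `C¹` function. -/
theorem integral_mul_dirDeriv {f g : E n → ℝ} (hf : ContDiff ℝ 1 f) (hg : ContDiff ℝ 1 g)
    (hc : HasCompactSupport f) (e : E n) :
    ∫ x, f x * dirDeriv e g x = -∫ x, dirDeriv e f x * g x := by
  have hfc := hf.continuous
  have hgc := hg.continuous
  have hf' : Continuous (dirDeriv e f) := (hf.continuous_fderiv one_ne_zero).clm_apply continuous_const
  have hg' : Continuous (dirDeriv e g) := (hg.continuous_fderiv one_ne_zero).clm_apply continuous_const
  refine integral_mul_fderiv_eq_neg_fderiv_mul_of_integrable (𝕜 := ℝ) ?_ ?_ ?_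
    (fun x _ => hf.differentiable one_ne_zero x) (fun x _ => hg.differentiable one_ne_zero x)
  · exact (hf'.mul hgc).integrable_of_hasCompactSupport ((hasCompactSupport_dirDeriv hc e).mul_right)
  · exact (hfc.mul hg').integrable_of_hasCompactSupport hc.mul_right
  · exact (hfc.mul hgc).integrable_of_hasCompactSupport hc.mul_right

theorem dirDeriv_eq_sum (e : E n) (u : E n → ℝ) (x : E n) :
    dirDeriv e u x = ∑ i, e i * pd i u x := by
  have he : e = ∑ i, e i • (EuclideanSpace.single i (1 : ℝ) : E n) := by
    conv_lhs => rw [← (EuclideanSpace.basisFun (Fin n) ℝ).sum_repr e]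
    simp
  unfold dirDeriv pd
  conv_lhs => rw [he]
  simp

theorem sq_sum_mul_le (e : E n) (a : Fin n → ℝ) :
    (∑ i, e i * a i) ^ 2 ≤ ‖e‖ ^ 2 * ∑ i, a i ^ 2 := by
  rw [EuclideanSpace.norm_sq_eq]
  simpa using Finset.sum_mul_sq_le_sq_mul_sq Finset.univ (fun i => e i) a

/-- Two integrations by parts turn $\int(\partial_i\partial_jv)^2$ into
$\int\partial_i^2v\,\partial_j^2v$; summing gives the square of the Laplacian. -/
theorem sum_integral_sq_pd_pd {v : E n → ℝ} (hv : ContDiff ℝ ∞ v) (hc : HasCompactSupport v) :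
    ∑ i, ∑ j, ∫ x, pd i (pd j v) x ^ 2 = ∫ x, lap v x ^ 2 := by
  have hs1 : ∀ i, ContDiff ℝ ∞ (pd i v) := contDiff_pd hv
  have hs2 : ∀ i j, ContDiff ℝ ∞ (pd i (pd j v)) := fun i j => contDiff_pd (hs1 j) i
  have hc2 : ∀ i j, HasCompactSupport (pd i (pd j v)) := fun i j =>
    hasCompactSupport_pd (hasCompactSupport_pd hc j) i
  have one {f : E n → ℝ} (hf : ContDiff ℝ ∞ f) : ContDiff ℝ 1 f := by
    exact_mod_cast contDiff_infty.1 hf 1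
  have key : ∀ i j, ∫ x, pd i (pd j v) x ^ 2 = ∫ x, pd i (pd i v) x * pd j (pd j v) x := by
    intro i j
    have h1 := integral_mul_dirDeriv (one (hs2 i j)) (one (hs1 j)) (hc2 i j)
      (EuclideanSpace.single i 1)
    have h2 := integral_mul_dirDeriv (one (hs2 i i)) (one (hs1 j)) (hc2 i i)
      (EuclideanSpace.single j 1)
    simp only [← pd_eq_dirDeriv] at h1 h2
    have h3 : pd i (pd i (pd j v)) = pd j (pd i (pd i v)) := by
      simp only [pd_eq_dirDeriv]
      rw [dirDeriv_comm hv, dirDeriv_comm (contDiff_dirDeriv hv _)]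
    rw [h3] at h1
    rw [h2, ← h1]
    simp only [sq]
  simp only [key]
  have hint : ∀ i j, Integrable (fun x => pd i (pd i v) x * pd j (pd j v) x) := fun i j =>
    ((hs2 i i).continuous.mul (hs2 j j).continuous).integrable_of_hasCompactSupport
      (hc2 i i).mul_right
  have : ∀ x, lap v x ^ 2 = ∑ i, ∑ j, pd i (pd i v) x * pd j (pd j v) x := by
    intro x
    rw [sq, lap, Finset.sum_mul_sum]
  simp only [this]
  rw [integral_finsetSum _ fun i _ => integrable_finsetSum _ fun j _ => hint i j]
  refine Finset.sum_congr rfl fun i _ => ?_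
  rw [integral_finsetSum _ fun j _ => hint i j]

theorem hasCompactSupport_sq {v : E n → ℝ} (hc : HasCompactSupport v) :
    HasCompactSupport (fun x => v x ^ 2) :=
  hc.comp_left (g := fun t : ℝ => t ^ 2) (by norm_num)

/-- Since $\partial_ix_i=1$, integration by parts gives $\int v^2=-2\int x_i\,v\,\partial_iv$. With
$|x_i|\le R$ on the support, Young's inequality absorbs half of the left side. -/
theorem poincare {v : E n → ℝ} (hv : ContDiff ℝ ∞ v) (hc : HasCompactSupport v) {R : ℝ}
    (hR : ∀ x ∈ tsupport v, ‖x‖ ≤ R) (i : Fin n) :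
    ∫ x, v x ^ 2 ≤ 4 * R ^ 2 * ∫ x, pd i v x ^ 2 := by
  have one {f : E n → ℝ} (hf : ContDiff ℝ ∞ f) : ContDiff ℝ 1 f := by
    exact_mod_cast contDiff_infty.1 hf 1
  let g : E n → ℝ := fun x => x i
  have hgd : ∀ x, HasFDerivAt g (EuclideanSpace.proj (𝕜 := ℝ) i : E n →L[ℝ] ℝ) x := fun x =>
    (EuclideanSpace.proj (𝕜 := ℝ) i : E n →L[ℝ] ℝ).hasFDerivAt
  have hgs : ContDiff ℝ ∞ g := (EuclideanSpace.proj (𝕜 := ℝ) i : E n →L[ℝ] ℝ).contDiff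
  have hg1 : ∀ x, dirDeriv (EuclideanSpace.single i 1) g x = 1 := by
    intro x
    simp [dirDeriv, (hgd x).fderiv]
  have hv2 : ∀ x, dirDeriv (EuclideanSpace.single i 1) (fun x => v x ^ 2) x
      = 2 * v x * pd i v x := by
    intro x
    have := ((hv.differentiable (by simp) x).hasFDerivAt.pow 2)
    simp [dirDeriv, this.fderiv, pd]
  have h := integral_mul_dirDeriv (one (hv.pow 2)) (one hgs)
    (hasCompactSupport_sq hc) (EuclideanSpace.single i 1)
  simp only [hg1, hv2, mul_one] at h
  have hvc := hv.continuous
  have hpc := (contDiff_pd hv i).continuous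
  have hpcs := hasCompactSupport_pd hc i
  have i1 : Integrable (fun x => v x ^ 2) :=
    (hvc.pow 2).integrable_of_hasCompactSupport (hasCompactSupport_sq hc)
  have i2 : Integrable (fun x => pd i v x ^ 2) :=
    (hpc.pow 2).integrable_of_hasCompactSupport (hasCompactSupport_sq hpcs)
  have hle : ∫ x, -(2 * v x * pd i v x * g x) ≤ ∫ x, (1 / 2 * v x ^ 2 + 2 * R ^ 2 * pd i v x ^ 2) := by
    refine integral_mono (((continuous_const.mul hvc).mul hpc).mul
      hgs.continuous |>.neg.integrable_of_hasCompactSupport ?_)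
      ((i1.const_mul _).add (i2.const_mul _)) fun x => ?_
    · refine HasCompactSupport.comp_left (g := fun t : ℝ => -t) ?_ neg_zero
      exact (hpcs.mul_left (f := fun x => 2 * v x)).mul_right
    · by_cases hx : x ∈ tsupport v
      · have h1 : |g x| ≤ R := le_trans (by simpa using PiLp.norm_apply_le x i) (hR x hx)
        have h2 : g x ^ 2 ≤ R ^ 2 := sq_le_sq' (abs_le.1 h1).1 (abs_le.1 h1).2
        have h3 : 0 ≤ (v x + 2 * (pd i v x * g x)) ^ 2 := sq_nonneg _
        have h4 := mul_le_mul_of_nonneg_left h2 (sq_nonneg (pd i v x))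
        change -(2 * v x * pd i v x * g x) ≤ _
        nlinarith
      · have : v x = 0 := image_eq_zero_of_notMem_tsupport hx
        simp only [this]
        have := mul_nonneg (sq_nonneg R) (sq_nonneg (pd i v x))
        nlinarith
  rw [integral_add (i1.const_mul _) (i2.const_mul _), integral_const_mul, integral_const_mul,
    integral_neg, ← h] at hle
  linarith

theorem tsupport_pd_subset (v : E n → ℝ) (i : Fin n) : tsupport (pd i v) ⊆ tsupport v :=
  tsupport_fderiv_apply_subset ℝ _

/-- The `H²`-norm of a test function is controlled by the `L₂`-norm of its Laplacian. -/
theorem integral_sobolev_le {v : E n → ℝ} (hv : ContDiff ℝ ∞ v) (hc : HasCompactSupport v) {R : ℝ}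
    (hR : ∀ x ∈ tsupport v, ‖x‖ ≤ R) (i₀ : Fin n) :
    (∫ x, v x ^ 2) + (∑ i, ∫ x, pd i v x ^ 2) + ∑ i, ∑ j, ∫ x, pd i (pd j v) x ^ 2
      ≤ (1 + 4 * R ^ 2 + 16 * R ^ 4) * ∫ x, lap v x ^ 2 := by
  rw [← sum_integral_sq_pd_pd hv hc]
  set T := ∑ i, ∑ j, ∫ x, pd i (pd j v) x ^ 2 with hT
  have h1 : ∀ i, ∫ x, pd i v x ^ 2 ≤ 4 * R ^ 2 * ∫ x, pd i (pd i v) x ^ 2 := fun i =>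
    poincare (contDiff_pd hv i) (hasCompactSupport_pd hc i)
      (fun x hx => hR x (tsupport_pd_subset v i hx)) i
  have h2 : ∑ i, ∫ x, pd i v x ^ 2 ≤ 4 * R ^ 2 * T := by
    rw [hT, Finset.mul_sum]
    refine Finset.sum_le_sum fun i _ => (h1 i).trans ?_
    refine mul_le_mul_of_nonneg_left ?_ (by positivity)
    exact Finset.single_le_sum (f := fun j => ∫ x, pd i (pd j v) x ^ 2)
      (fun j _ => integral_nonneg fun x => sq_nonneg _) (Finset.mem_univ i)
  have h3 := poincare hv hc hR i₀
  have h4 : ∫ x, pd i₀ v x ^ 2 ≤ ∑ i, ∫ x, pd i v x ^ 2 :=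
    Finset.single_le_sum (f := fun i => ∫ x, pd i v x ^ 2)
      (fun j _ => integral_nonneg fun x => sq_nonneg _) (Finset.mem_univ i₀)
  have h5 := mul_le_mul_of_nonneg_left (h4.trans h2) (by positivity : 0 ≤ 4 * R ^ 2)
  nlinarith

/-! ### Weighted Caccioppoli inequality -/

theorem hasDerivAt_posPart_pow (m : ℕ) (t : ℝ) :
    HasDerivAt (fun s : ℝ => (max s 0) ^ (m + 2)) ((m + 2) * (max t 0) ^ (m + 1)) t := by
  have hne : ∀ s : ℝ, s ≠ 0 →
      HasDerivAt (fun s : ℝ => (max s 0) ^ (m + 2)) ((m + 2) * (max s 0) ^ (m + 1)) s := by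
    intro s hs
    rcases lt_or_gt_of_ne hs with h | h
    · have : (fun s : ℝ => (max s 0) ^ (m + 2)) =ᶠ[nhds s] fun _ => 0 := by
        filter_upwards [gt_mem_nhds h] with y hy
        simp [max_eq_right hy.le]
      simpa [max_eq_right h.le] using (hasDerivAt_const s (0 : ℝ)).congr_of_eventuallyEq this
    · have : (fun s : ℝ => (max s 0) ^ (m + 2)) =ᶠ[nhds s] fun s => s ^ (m + 2) := by
        filter_upwards [lt_mem_nhds h] with y hy
        simp [max_eq_left hy.le]
      have h2 := (hasDerivAt_pow (m + 2) s).congr_of_eventuallyEq this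
      simpa [max_eq_left h.le] using h2
  rcases eq_or_ne t 0 with rfl | ht
  · exact hasDerivAt_of_hasDerivAt_of_ne (f := fun s : ℝ => (max s 0) ^ (m + 2))
      (g := fun s : ℝ => (m + 2) * (max s 0) ^ (m + 1)) (x := 0) hne
      (by fun_prop) (by fun_prop)
  · exact hne t ht

theorem contDiff_posPart_pow (m : ℕ) : ContDiff ℝ 1 (fun s : ℝ => (max s 0) ^ (m + 2)) := by
  rw [contDiff_one_iff_deriv]
  refine ⟨fun t => (hasDerivAt_posPart_pow m t).differentiableAt, ?_⟩
  have : deriv (fun s : ℝ => (max s 0) ^ (m + 2)) = fun t : ℝ => ((m : ℝ) + 2) * (max t 0) ^ (m + 1) :=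
    funext fun t => (hasDerivAt_posPart_pow m t).deriv
  rw [this]
  fun_prop

/-- A weighted Caccioppoli inequality on a ball. -/
theorem caccioppoli {u : E n → ℝ} (hu : ContDiff ℝ ∞ u) {c : E n} {R : ℝ} (hR : 0 < R)
    (hlap : ∀ x ∈ Metric.ball c R, lap u x = 0) (k : ℕ) (e : E n) :
    ∫ x in Metric.ball c R, (R ^ 2 - ‖x - c‖ ^ 2) ^ (2 * (k + 1)) * dirDeriv e u x ^ 2
      ≤ (4 * R * (k + 1) * ‖e‖) ^ 2 *
        ∫ x in Metric.ball c R, (R ^ 2 - ‖x - c‖ ^ 2) ^ (2 * k) * u x ^ 2 := by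
  have one {f : E n → ℝ} (hf : ContDiff ℝ ∞ f) : ContDiff ℝ 1 f := by
    exact_mod_cast contDiff_infty.1 hf 1
  -- The weight is truncated at zero so that a power of it is a $C^1$ cutoff on the whole space,
  -- supported where $u$ is harmonic.
  set D : E n → ℝ := fun x => max (R ^ 2 - ‖x - c‖ ^ 2) 0 with hD
  have hDc : Continuous D := by fun_prop
  have hD0 : ∀ x, x ∉ Metric.ball c R → D x = 0 := by
    intro x hx
    rw [Metric.mem_ball, not_lt, dist_eq_norm] at hx
    have : R ^ 2 ≤ ‖x - c‖ ^ 2 := by gcongr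
    exact max_eq_right (by linarith)
  have hD1 : ∀ x ∈ Metric.ball c R, D x = R ^ 2 - ‖x - c‖ ^ 2 := by
    intro x hx
    rw [Metric.mem_ball, dist_eq_norm] at hx
    have : ‖x - c‖ ^ 2 ≤ R ^ 2 := by gcongr
    exact max_eq_left (by linarith)
  have hDnn : ∀ x, 0 ≤ D x := fun x => le_max_right _ _
  have hDcs : ∀ m, HasCompactSupport (fun x => D x ^ (m + 1)) := by
    intro m
    refine HasCompactSupport.of_support_subset_isCompact (isCompact_closedBall c R) ?_
    intro x hx
    by_contra h
    exact hx (by simp [hD0 x (fun h' => h (Metric.ball_subset_closedBall h'))])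
  set ψ : E n → ℝ := fun x => D x ^ (2 * k + 2) with hψ
  have hq : ContDiff ℝ 1 (fun x : E n => R ^ 2 - ‖x - c‖ ^ 2) :=
    contDiff_const.sub ((contDiff_id.sub contDiff_const).norm_sq ℝ)
  have hψs : ContDiff ℝ 1 ψ := (contDiff_posPart_pow (2 * k)).comp hq
  have hψd : ∀ i x, dirDeriv (EuclideanSpace.single i 1) ψ x
      = (2 * k + 2) * D x ^ (2 * k + 1) * (-2 * (x - c) i) := by
    intro i x
    have h1 : HasFDerivAt (fun x : E n => R ^ 2 - ‖x - c‖ ^ 2)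
        (-(2 • (innerSL ℝ (x - c)).comp (ContinuousLinearMap.id ℝ (E n)))) x := by
      have := (((hasFDerivAt_id x).sub_const c).norm_sq).const_sub (R ^ 2)
      exact this
    have h2 := (hasDerivAt_posPart_pow (2 * k) (R ^ 2 - ‖x - c‖ ^ 2)).comp_hasFDerivAt x h1
    have h3 : fderiv ℝ ψ x = _ := h2.fderiv
    simp only [dirDeriv, h3]
    simp [EuclideanSpace.inner_single_right, hD]
  have hu1 := one hu
  have hp : ∀ i, ContDiff ℝ ∞ (pd i u) := contDiff_pd hu
  have hψu : ContDiff ℝ 1 (fun x => ψ x * u x) := hψs.mul hu1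
  have hψuc : HasCompactSupport (fun x => ψ x * u x) := (hDcs (2 * k + 1)).mul_right
  have hprod : ∀ i x, dirDeriv (EuclideanSpace.single i 1) (fun x => ψ x * u x) x
      = ψ x * pd i u x + u x * ((2 * k + 2) * D x ^ (2 * k + 1) * (-2 * (x - c) i)) := by
    intro i x
    have := (hψs.differentiable one_ne_zero x).hasFDerivAt.mul
      (hu1.differentiable one_ne_zero x).hasFDerivAt
    rw [← hψd i x]
    simp only [dirDeriv, pd]
    rw [show (fun x => ψ x * u x) = ψ * u from rfl, this.fderiv]
    simp
  have hibp : ∀ i, ∫ x, ψ x * u x * pd i (pd i u) x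
      = -∫ x, (ψ x * pd i u x ^ 2 + (2 * k + 2) * D x ^ (2 * k + 1) * (-2 * u x) *
          ((x - c) i * pd i u x)) := by
    intro i
    have := integral_mul_dirDeriv hψu (one (hp i)) hψuc (EuclideanSpace.single i 1)
    rw [pd_eq_dirDeriv i (pd i u), this]
    congr 1
    refine integral_congr_ae (Filter.Eventually.of_forall fun x => ?_)
    simp only [hprod]
    ring
  have hci : ∀ i : Fin n, Continuous fun x : E n => (x - c) i := fun i =>
    ((EuclideanSpace.proj (𝕜 := ℝ) i : E n →L[ℝ] ℝ).continuous).comp (continuous_id.sub continuous_const)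
  have huc := hu.continuous
  have hpc : ∀ i, Continuous (pd i u) := fun i => (hp i).continuous
  have iA : ∀ i, Integrable (fun x => ψ x * pd i u x ^ 2) := fun i =>
    (hψs.continuous.mul ((hpc i).pow 2)).integrable_of_hasCompactSupport (hDcs (2 * k + 1)).mul_right
  have iB : ∀ i, Integrable (fun x => (2 * k + 2) * D x ^ (2 * k + 1) * (-2 * u x) *
      ((x - c) i * pd i u x)) := fun i => by
    refine Continuous.integrable_of_hasCompactSupport ?_
      ((hDcs (2 * k)).mul_left.mul_right.mul_right)
    have := hci i
    have := hpc i
    fun_prop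
  have iC : ∀ i, Integrable (fun x => ψ x * u x * pd i (pd i u) x) := fun i =>
    (hψu.continuous.mul (contDiff_pd (hp i) i).continuous).integrable_of_hasCompactSupport
      hψuc.mul_right
  set G : E n → ℝ := fun x => ∑ i, pd i u x ^ 2 with hG
  set T : E n → ℝ := fun x => ∑ i, (x - c) i * pd i u x with hT
  have hGc : Continuous G := continuous_finsetSum _ fun i _ => (hpc i).pow 2
  have hTc : Continuous T := continuous_finsetSum _ fun i _ => (hci i).mul (hpc i)
  have iψG : Integrable (fun x => ψ x * G x) :=
    (hψs.continuous.mul hGc).integrable_of_hasCompactSupport (hDcs (2 * k + 1)).mul_right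
  have iDT : Integrable (fun x => (2 * k + 2) * D x ^ (2 * k + 1) * (-2 * u x) * T x) := by
    refine Continuous.integrable_of_hasCompactSupport (by fun_prop)
      ((hDcs (2 * k)).mul_left.mul_right.mul_right)
  -- This is $\Delta u=0$ tested with $\psi u$: the integrand vanishes in the ball by harmonicity
  -- and outside because $\psi=0$.
  have hzero : ∫ x, (ψ x * G x + (2 * k + 2) * D x ^ (2 * k + 1) * (-2 * u x) * T x) = 0 := by
    have h1 : ∑ i, ∫ x, ψ x * u x * pd i (pd i u) x = 0 := by
      rw [← integral_finsetSum _ fun i _ => iC i]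
      refine integral_eq_zero_of_ae (Filter.Eventually.of_forall fun x => ?_)
      simp only [← Finset.mul_sum, Pi.zero_apply]
      by_cases hx : x ∈ Metric.ball c R
      · rw [show ∑ i, pd i (pd i u) x = lap u x from rfl, hlap x hx, mul_zero]
      · simp [hψ, hD0 x hx]
    simp only [hibp] at h1
    have hsum : ∀ i ∈ Finset.univ, Integrable (fun x => ψ x * pd i u x ^ 2 +
        (2 * k + 2) * D x ^ (2 * k + 1) * (-2 * u x) * ((x - c) i * pd i u x)) :=
      fun i _ => (iA i).add (iB i)
    rw [Finset.sum_neg_distrib, neg_eq_zero, ← integral_finsetSum _ hsum] at h1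
    rw [← h1]
    refine integral_congr_ae (Filter.Eventually.of_forall fun x => ?_)
    simp only [hG, hT, Finset.mul_sum, Finset.sum_add_distrib]
  rw [integral_add iψG iDT] at hzero
  set B := Metric.ball c R with hB
  have toBall : ∀ f : E n → ℝ, (∀ x, x ∉ B → f x = 0) → ∫ x, f x = ∫ x in B, f x := fun f hf =>
    (setIntegral_eq_integral_of_forall_compl_eq_zero hf).symm
  have iball : ∀ {f : E n → ℝ}, Continuous f → IntegrableOn f B := fun {f} hf =>
    (hf.continuousOn.integrableOn_compact (isCompact_closedBall c R)).mono_set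
      Metric.ball_subset_closedBall
  have hDk : Continuous fun x => D x ^ (2 * k) * u x ^ 2 := by fun_prop
  have hmain : ∫ x in B, ψ x * G x ≤ 16 * (k + 1) ^ 2 * R ^ 2 * ∫ x in B, D x ^ (2 * k) * u x ^ 2 := by
    have hle : ∫ x in B, -((2 * k + 2) * D x ^ (2 * k + 1) * (-2 * u x) * T x)
        ≤ ∫ x in B, (1 / 2 * (ψ x * G x) + 8 * (k + 1) ^ 2 * R ^ 2 * (D x ^ (2 * k) * u x ^ 2)) := by
      refine setIntegral_mono_on (iDT.neg.integrableOn)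
        ((iψG.integrableOn.const_mul _).add ((iball hDk).const_mul _)) Metric.isOpen_ball.measurableSet
        fun x hx => ?_
      have hx' : ‖x - c‖ ≤ R := by
        rw [hB, Metric.mem_ball, dist_eq_norm] at hx
        exact hx.le
      have hTG : T x ^ 2 ≤ R ^ 2 * G x := by
        refine (sq_sum_mul_le (x - c) fun i => pd i u x).trans ?_
        have : 0 ≤ G x := Finset.sum_nonneg fun i _ => sq_nonneg _
        gcongr
      -- Young's inequality as a completed square. Differentiating $D^{2k+2}$ costs one power of
      -- $D$, so the cross term splits into $D^{k+1}T$ and $D^ku$; the factor $4(k+1)R^2$ leaves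
      -- exactly half of $\psi G$ to absorb.
      have h1 : 0 ≤ (D x ^ (k + 1) * T x - 4 * (k + 1) * R ^ 2 * (D x ^ k * u x)) ^ 2 := sq_nonneg _
      have h2 : D x ^ (2 * k + 2) * T x ^ 2 ≤ D x ^ (2 * k + 2) * (R ^ 2 * G x) :=
        mul_le_mul_of_nonneg_left hTG (pow_nonneg (hDnn x) _)
      have hR2 : 0 < R ^ 2 := by positivity
      have h3 : R ^ 2 * (-((2 * k + 2) * D x ^ (2 * k + 1) * (-2 * u x) * T x))
          ≤ R ^ 2 * (1 / 2 * (D x ^ (2 * k + 2) * G x)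
            + 8 * (k + 1) ^ 2 * R ^ 2 * (D x ^ (2 * k) * u x ^ 2)) := by
        have e1 : (D x ^ (k + 1) * T x - 4 * (k + 1) * R ^ 2 * (D x ^ k * u x)) ^ 2
          = D x ^ (2 * k + 2) * T x ^ 2 - 8 * (k + 1) * R ^ 2 * D x ^ (2 * k + 1) * u x * T x
            + 16 * (k + 1) ^ 2 * R ^ 2 * R ^ 2 * (D x ^ (2 * k) * u x ^ 2) := by ring
        rw [e1] at h1
        nlinarith
      exact le_of_mul_le_mul_left h3 hR2
    rw [integral_add (iψG.integrableOn.const_mul _) ((iball hDk).const_mul _), integral_const_mul,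
      integral_const_mul, integral_neg] at hle
    rw [toBall (fun x => ψ x * G x) fun x hx => by simp [hψ, hD0 x hx],
      toBall _ fun x hx => by simp [hD0 x hx]] at hzero
    linarith
  have hDB : ∫ x in B, (R ^ 2 - ‖x - c‖ ^ 2) ^ (2 * k) * u x ^ 2 = ∫ x in B, D x ^ (2 * k) * u x ^ 2 :=
    setIntegral_congr_fun Metric.isOpen_ball.measurableSet fun x hx => by simp only [hD1 x hx]
  rw [hDB]
  calc ∫ x in B, (R ^ 2 - ‖x - c‖ ^ 2) ^ (2 * (k + 1)) * dirDeriv e u x ^ 2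
      ≤ ∫ x in B, ‖e‖ ^ 2 * (ψ x * G x) := by
        refine setIntegral_mono_on ?_ (iψG.integrableOn.const_mul _) Metric.isOpen_ball.measurableSet
          fun x hx => ?_
        · have := (contDiff_dirDeriv hu e).continuous
          exact iball (by fun_prop)
        · rw [← hD1 x hx, dirDeriv_eq_sum]
          have := mul_le_mul_of_nonneg_left (sq_sum_mul_le e fun i => pd i u x)
            (pow_nonneg (hDnn x) (2 * (k + 1)))
          calc _ ≤ _ := this
            _ = _ := by simp only [hψ, hG]; ring
    _ = ‖e‖ ^ 2 * ∫ x in B, ψ x * G x := integral_const_mul _ _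
    _ ≤ ‖e‖ ^ 2 * (16 * (k + 1) ^ 2 * R ^ 2 * ∫ x in B, D x ^ (2 * k) * u x ^ 2) := by gcongr
    _ = _ := by ring

/-! ### L₂-norms on balls and interior derivative estimates -/

/-- The real-valued `L₂(S)`-norm of a square integrable function. -/
def l2norm (S : Set (E n)) (f : E n → ℝ) : ℝ := √(∫ x in S, f x ^ 2)

theorem l2norm_nonneg (S : Set (E n)) (f : E n → ℝ) : 0 ≤ l2norm S f := Real.sqrt_nonneg _

theorem l2norm_sq (S : Set (E n)) (f : E n → ℝ) : l2norm S f ^ 2 = ∫ x in S, f x ^ 2 :=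
  Real.sq_sqrt (integral_nonneg fun _ => sq_nonneg _)

theorem abs_integral_mul_le_l2norm {S : Set (E n)} {f g : E n → ℝ}
    (hf : MemLp f 2 (volume.restrict S)) (hg : MemLp g 2 (volume.restrict S)) :
    |∫ x in S, f x * g x| ≤ l2norm S f * l2norm S g := by
  have h := integral_mul_norm_le_Lp_mul_Lq (μ := volume.restrict S) (f := f) (g := g)
    Real.HolderConjugate.two_two (by simpa using hf) (by simpa using hg)
  simp only [Real.norm_eq_abs, ← Real.sqrt_eq_rpow, Real.rpow_two, sq_abs] at h
  refine le_trans ?_ h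
  simp only [← abs_mul]
  exact abs_integral_le_integral_abs

theorem memLp_two_of_continuous {f : E n → ℝ} (hf : Continuous f) (c : E n) (r : ℝ) :
    MemLp f 2 (volume.restrict (Metric.ball c r)) := by
  rw [memLp_two_iff_integrable_sq hf.aestronglyMeasurable]
  exact ((hf.pow 2).continuousOn.integrableOn_compact (isCompact_closedBall c r)).mono_set
    Metric.ball_subset_closedBall

theorem integrableOn_ball_of_continuous {f : E n → ℝ} (hf : Continuous f) (c : E n) (r : ℝ) :
    IntegrableOn f (Metric.ball c r) :=
  (hf.continuousOn.integrableOn_compact (isCompact_closedBall c r)).mono_set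
    Metric.ball_subset_closedBall

/-- Directional derivatives of harmonic functions are harmonic, so `caccioppoli` iterates. The
$k$-th step costs $4R(k+1)\|e\|$, and the product of these factors is the factorial that analyticity
allows. -/
theorem weighted_iterate_dirDeriv_le {u : E n → ℝ} (hu : ContDiff ℝ ∞ u) {c : E n} {R : ℝ}
    (hR : 0 < R) (hlap : ∀ x ∈ Metric.ball c R, lap u x = 0) (e : E n) (k : ℕ) :
    ∫ x in Metric.ball c R, (R ^ 2 - ‖x - c‖ ^ 2) ^ (2 * k) * (dirDeriv e)^[k] u x ^ 2
      ≤ ((4 * R * ‖e‖) ^ k * k.factorial) ^ 2 * ∫ x in Metric.ball c R, u x ^ 2 := by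
  induction k with
  | zero => simp
  | succ k ih =>
    simp only [Function.iterate_succ_apply']
    refine (caccioppoli (contDiff_iterate_dirDeriv hu e k) hR
      (lap_iterate_dirDeriv_eq_zero hu e Metric.isOpen_ball hlap k) k e).trans ?_
    refine (mul_le_mul_of_nonneg_left ih (sq_nonneg _)).trans (le_of_eq ?_)
    rw [Nat.factorial_succ]
    push_cast
    ring

/-- Interior estimates for the iterated directional derivatives of harmonic functions. -/
theorem l2norm_iterate_dirDeriv_le {u : E n → ℝ} (hu : ContDiff ℝ ∞ u) {c : E n} {R : ℝ}
    (hR : 0 < R) (hlap : ∀ x ∈ Metric.ball c R, lap u x = 0) (e : E n) (k : ℕ) :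
    l2norm (Metric.ball c (R / 2)) ((dirDeriv e)^[k] u)
      ≤ (6 * ‖e‖ / R) ^ k * k.factorial * l2norm (Metric.ball c R) u := by
  have hk := (contDiff_iterate_dirDeriv hu e k).continuous
  have hsub : Metric.ball c (R / 2) ⊆ Metric.ball c R := Metric.ball_subset_ball (by linarith)
  -- On the half ball the weight is at least $R^2-(R/2)^2=\tfrac34R^2$.
  have h1 : ((3 / 4 * R ^ 2) ^ k * l2norm (Metric.ball c (R / 2)) ((dirDeriv e)^[k] u)) ^ 2
      ≤ ((4 * R * ‖e‖) ^ k * k.factorial * l2norm (Metric.ball c R) u) ^ 2 := by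
    rw [mul_pow, l2norm_sq, mul_pow _ (l2norm _ _), l2norm_sq]
    refine le_trans ?_ (weighted_iterate_dirDeriv_le hu hR hlap e k)
    have hc : Continuous fun x => (R ^ 2 - ‖x - c‖ ^ 2) ^ (2 * k) * (dirDeriv e)^[k] u x ^ 2 := by
      fun_prop
    rw [← integral_const_mul]
    refine le_trans ?_ (setIntegral_mono_set (integrableOn_ball_of_continuous hc c R)
      (Filter.Eventually.of_forall fun x => ?_) hsub.eventuallyLE)
    · refine setIntegral_mono_on ((integrableOn_ball_of_continuous (hk.pow 2) _ _).const_mul _)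
        (integrableOn_ball_of_continuous hc _ _) Metric.isOpen_ball.measurableSet fun x hx => ?_
      rw [← pow_mul, mul_comm k 2]
      rw [Metric.mem_ball, dist_eq_norm] at hx
      have : ‖x - c‖ ^ 2 ≤ (R / 2) ^ 2 := by gcongr
      gcongr
      nlinarith
    · simp only [pow_mul, Pi.zero_apply]
      positivity
  have h2 := abs_le_of_sq_le_sq h1 (by have := l2norm_nonneg (Metric.ball c R) u; positivity)
  have h3 := (abs_le.1 h2).2
  have hp : 0 < (3 / 4 * R ^ 2) ^ k := by positivity
  refine le_of_mul_le_mul_left (h3.trans ?_) hp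
  -- The exact quotient is $16\|e\|/(3R)$, rounded up to $6\|e\|/R$.
  have h4 : (4 * R * ‖e‖) ^ k ≤ (3 / 4 * R ^ 2) ^ k * (6 * ‖e‖ / R) ^ k := by
    rw [← mul_pow]
    refine pow_le_pow_left₀ (by positivity) ?_ k
    have : 3 / 4 * R ^ 2 * (6 * ‖e‖ / R) = 9 / 2 * (R * ‖e‖) := by field_simp; ring
    rw [this]
    have : 0 ≤ R * ‖e‖ := by positivity
    linarith
  have hn := l2norm_nonneg (Metric.ball c R) u
  calc (4 * R * ‖e‖) ^ k * k.factorial * l2norm (Metric.ball c R) u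
      ≤ ((3 / 4 * R ^ 2) ^ k * (6 * ‖e‖ / R) ^ k) * k.factorial * l2norm (Metric.ball c R) u := by
        gcongr
    _ = _ := by ring

/-! ### Propagation of smallness for smooth harmonic functions -/

/-- Taylor's formula on `[0, 1]` for a chain of antiderivatives. -/
theorem taylor_bound_of_hasDerivAt (N : ℕ) {M : ℝ} {g : ℕ → ℝ → ℝ}
    (hg : ∀ k s, HasDerivAt (g k) (g (k + 1) s) s) (hM : ∀ s ∈ Icc (0 : ℝ) 1, |g N s| ≤ M) :
    ∀ s ∈ Icc (0 : ℝ) 1,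
      |g 0 s - ∑ k ∈ Finset.range N, g k 0 * s ^ k / k.factorial| ≤ M * s ^ N / N.factorial := by
  induction N generalizing g with
  | zero => intro s hs; simpa using hM s hs
  | succ N ih =>
    -- The derivative of the Taylor remainder is the remainder of one order less for the shifted
    -- chain, so the induction integrates its bound.
    have ih' := ih (g := fun k => g (k + 1)) (fun k s => hg (k + 1) s) hM
    have hd : ∀ s, HasDerivAt
        (fun s => g 0 s - ∑ k ∈ Finset.range (N + 1), g k 0 * s ^ k / k.factorial)
        (g 1 s - ∑ k ∈ Finset.range N, g (k + 1) 0 * s ^ k / k.factorial) s := by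
      intro s
      refine (hg 0 s).sub ?_
      simp only [Finset.sum_range_succ' _ N]
      have h : ∀ k ∈ Finset.range N, HasDerivAt
          (fun s : ℝ => g (k + 1) 0 * s ^ (k + 1) / (k + 1).factorial)
          (g (k + 1) 0 * s ^ k / k.factorial) s := by
        intro k _
        have h1 := ((hasDerivAt_pow (k + 1) s).const_mul (g (k + 1) 0)).div_const
          ((k + 1).factorial : ℝ)
        refine h1.congr_deriv ?_
        rw [Nat.factorial_succ]
        have : (k.factorial : ℝ) ≠ 0 := by positivity
        push_cast
        field_simp
      have h2 := (HasDerivAt.fun_sum h).add_const (g 0 0 * s ^ 0 / (Nat.factorial 0))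
      simpa using h2
    have hB : ∀ s, HasDerivAt (fun s : ℝ => M * s ^ (N + 1) / (N + 1).factorial)
        (M * s ^ N / N.factorial) s := by
      intro s
      have h1 := ((hasDerivAt_pow (N + 1) s).const_mul M).div_const ((N + 1).factorial : ℝ)
      refine h1.congr_deriv ?_
      rw [Nat.factorial_succ]
      have : (N.factorial : ℝ) ≠ 0 := by positivity
      push_cast
      field_simp
    intro s hs
    have := image_norm_le_of_norm_deriv_right_le_deriv_boundary (a := 0) (b := 1)
      (fun s _ => (hd s).continuousAt.continuousWithinAt) (fun s _ => (hd s).hasDerivWithinAt)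
      (B := fun s : ℝ => M * s ^ (N + 1) / (N + 1).factorial)
      (by simp [Finset.sum_range_succ' _ N]) hB
      (fun s hs' => ih' s ⟨hs'.1, hs'.2.le⟩) hs
    simpa using this

theorem hasDerivAt_integral_translate {f ψ : E n → ℝ} (hf : ContDiff ℝ ∞ f) (hψ : Continuous ψ)
    (e c : E n) (r s : ℝ) :
    HasDerivAt (fun s : ℝ => ∫ x in Metric.ball c r, f (x + s • e) * ψ x)
      (∫ x in Metric.ball c r, dirDeriv e f (x + s • e) * ψ x) s := by
  have hfc := hf.continuous
  have hdc := (contDiff_dirDeriv hf e).continuous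
  have hcont : Continuous fun p : ℝ × E n => dirDeriv e f (p.2 + p.1 • e) * ψ p.2 := by fun_prop
  obtain ⟨C, hC⟩ := ((isCompact_Icc (a := s - 1) (b := s + 1)).prod
    (isCompact_closedBall c r)).exists_bound_of_continuousOn hcont.continuousOn
  refine (hasDerivAt_integral_of_dominated_loc_of_deriv_le (bound := fun _ => C)
    (F := fun s x => f (x + s • e) * ψ x) (F' := fun s x => dirDeriv e f (x + s • e) * ψ x)
    (s := Icc (s - 1) (s + 1)) (Icc_mem_nhds (by linarith) (by linarith)) ?_ ?_ ?_ ?_ ?_ ?_).2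
  · exact Filter.Eventually.of_forall fun t =>
      (by fun_prop : Continuous fun x => f (x + t • e) * ψ x).aestronglyMeasurable
  · exact integrableOn_ball_of_continuous (by fun_prop) c r
  · exact (by fun_prop : Continuous fun x => dirDeriv e f (x + s • e) * ψ x).aestronglyMeasurable
  · refine ae_restrict_of_forall_mem Metric.isOpen_ball.measurableSet fun x hx t ht => ?_
    exact hC (t, x) ⟨ht, Metric.ball_subset_closedBall hx⟩
  · exact integrableOn_ball_of_continuous continuous_const c r
  · refine Filter.Eventually.of_forall fun x t _ => ?_
    have h1 : HasDerivAt (fun t : ℝ => x + t • e) e t := by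
      simpa using ((hasDerivAt_id t).smul_const e).const_add x
    exact (((hf.differentiable (by simp) _).hasFDerivAt.comp_hasDerivAt t h1)).mul_const (ψ x)

theorem l2norm_translate (f : E n → ℝ) (c v : E n) (r : ℝ) :
    l2norm (Metric.ball c r) (fun x => f (x + v)) = l2norm (Metric.ball (c + v) r) f := by
  unfold l2norm
  congr 1
  have h := (measurePreserving_add_right (volume : Measure (E n)) v).setIntegral_preimage_emb
    (MeasurableEquiv.addRight v).measurableEmbedding (fun x => f x ^ 2) (Metric.ball (c + v) r)
  rw [← h]
  congr 2
  ext x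
  simp [dist_eq_norm]

theorem l2norm_mono_of_continuous {f : E n → ℝ} (hf : Continuous f) {a b : E n} {r s : ℝ}
    (h : Metric.ball a r ⊆ Metric.ball b s) :
    l2norm (Metric.ball a r) f ≤ l2norm (Metric.ball b s) f :=
  Real.sqrt_le_sqrt (setIntegral_mono_set (integrableOn_ball_of_continuous (hf.pow 2) b s)
    (Filter.Eventually.of_forall fun _ => sq_nonneg _) h.eventuallyLE)

/-- Propagation of smallness for smooth harmonic functions from a small ball around `c` to a ball
around the nearby point `c + e`. -/
theorem l2norm_propagation_smooth {u : E n → ℝ} (hu : ContDiff ℝ ∞ u) {c e : E n} {r ρ : ℝ}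
    (hr : 0 < r) (hrρ : r ≤ ρ / 12) (he : ‖e‖ ≤ ρ / 12)
    (hlap : ∀ x ∈ Metric.ball (c + e) ρ, lap u x = 0) (N : ℕ) :
    l2norm (Metric.ball (c + e) r) u
      ≤ (∑ k ∈ Finset.range N, (3 * ‖e‖ / r) ^ k) * l2norm (Metric.ball c (2 * r)) u
        + (1 / 2) ^ N * l2norm (Metric.ball (c + e) ρ) u := by
  have hρ : 0 < ρ := by linarith
  -- Pairing translates of $u$ with $\psi$ reduces to a scalar Taylor expansion in $s$: at $s=1$ the
  -- pairing is $L^2$, while every bound carries one factor $L$, which cancels at the end.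
  set ψ : E n → ℝ := fun x => u (x + e) with hψ
  have huc := hu.continuous
  have hψc : Continuous ψ := by fun_prop
  set L := l2norm (Metric.ball (c + e) r) u with hL
  have hψL : l2norm (Metric.ball c r) ψ = L := l2norm_translate u c e r
  set δ := l2norm (Metric.ball c (2 * r)) u with hδ
  set M := l2norm (Metric.ball (c + e) ρ) u with hM
  have hL0 : 0 ≤ L := l2norm_nonneg _ _
  have hδ0 : 0 ≤ δ := l2norm_nonneg _ _
  have hM0 : 0 ≤ M := l2norm_nonneg _ _
  let g : ℕ → ℝ → ℝ := fun k s => ∫ x in Metric.ball c r, (dirDeriv e)^[k] u (x + s • e) * ψ x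
  have hg : ∀ k s, HasDerivAt (g k) (g (k + 1) s) s := by
    intro k s
    have := hasDerivAt_integral_translate (contDiff_iterate_dirDeriv hu e k) hψc e c r s
    simpa only [g, Function.iterate_succ_apply'] using this
  have hgb : ∀ k s, |g k s| ≤ l2norm (Metric.ball (c + s • e) r) ((dirDeriv e)^[k] u) * L := by
    intro k s
    have hk := (contDiff_iterate_dirDeriv hu e k).continuous
    have := abs_integral_mul_le_l2norm (S := Metric.ball c r)
      (f := fun x => (dirDeriv e)^[k] u (x + s • e)) (g := ψ)
      (memLp_two_of_continuous (by fun_prop) c r) (memLp_two_of_continuous hψc c r)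
    rwa [l2norm_translate, hψL] at this
  have hsub : Metric.ball c (2 * r) ⊆ Metric.ball (c + e) ρ := by
    refine Metric.ball_subset_ball' ?_
    rw [dist_eq_norm]
    simp only [sub_add_cancel_left, norm_neg]
    linarith
  -- The Taylor coefficients at $s=0$ see $u$ only near $c$, where it is small.
  have hg0 : ∀ k, |g k 0| ≤ (3 * ‖e‖ / r) ^ k * k.factorial * δ * L := by
    intro k
    refine (hgb k 0).trans (mul_le_mul_of_nonneg_right ?_ hL0)
    have := l2norm_iterate_dirDeriv_le hu (c := c) (R := 2 * r) (by linarith)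
      (fun x hx => hlap x (hsub hx)) e k
    rw [show 6 * ‖e‖ / (2 * r) = 3 * ‖e‖ / r by field_simp; ring,
      show 2 * r / 2 = r by ring] at this
    simpa using this
  -- The remainder uses the large ball: $r+\|e\|\le\rho/6$ keeps the translated balls within radius
  -- $\rho/2$ of $c+e$, and $6\|e\|/\rho\le1/2$ gives geometric decay.
  have hgN : ∀ s ∈ Icc (0 : ℝ) 1, |g N s| ≤ (1 / 2) ^ N * N.factorial * M * L := by
    intro s hs
    refine (hgb N s).trans (mul_le_mul_of_nonneg_right ?_ hL0)
    refine (l2norm_mono_of_continuous (b := c + e) (s := ρ / 2)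
      (contDiff_iterate_dirDeriv hu e N).continuous (Metric.ball_subset_ball' ?_)).trans ?_
    · have : c + s • e - (c + e) = (s - 1) • e := by module
      rw [dist_eq_norm, this, norm_smul, Real.norm_eq_abs]
      have : |s - 1| ≤ 1 := abs_le.2 ⟨by linarith [hs.1], by linarith [hs.2]⟩
      have := mul_le_mul_of_nonneg_right this (norm_nonneg e)
      linarith
    · refine (l2norm_iterate_dirDeriv_le hu hρ hlap e N).trans ?_
      have : 6 * ‖e‖ / ρ ≤ 1 / 2 := by
        rw [div_le_iff₀ hρ]; linarith
      gcongr
  have ht := taylor_bound_of_hasDerivAt N hg hgN 1 ⟨zero_le_one, le_rfl⟩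
  have h01 : g 0 1 = L ^ 2 := by
    have : g 0 1 = ∫ x in Metric.ball c r, ψ x ^ 2 := by
      simp only [g, Function.iterate_zero, id, one_smul, sq, hψ]
    rw [this, ← l2norm_sq, hψL]
  rw [h01] at ht
  simp only [one_pow, mul_one] at ht
  have hN : (N.factorial : ℝ) ≠ 0 := by positivity
  rw [show (1 / 2) ^ N * N.factorial * M * L / N.factorial = (1 / 2) ^ N * M * L by
    field_simp] at ht
  have hsum : ∑ k ∈ Finset.range N, g k 0 / k.factorial
      ≤ (∑ k ∈ Finset.range N, (3 * ‖e‖ / r) ^ k) * δ * L := by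
    rw [Finset.sum_mul, Finset.sum_mul]
    refine Finset.sum_le_sum fun k _ => ?_
    have hk : (0 : ℝ) < k.factorial := by positivity
    rw [div_le_iff₀ hk]
    refine ((le_abs_self _).trans (hg0 k)).trans (le_of_eq (by ring))
  have hfin : L * L ≤ ((∑ k ∈ Finset.range N, (3 * ‖e‖ / r) ^ k) * δ + (1 / 2) ^ N * M) * L := by
    have := (abs_le.1 ht).2
    nlinarith
  rcases hL0.eq_or_lt with h | h
  · rw [← h]
    positivity
  · exact le_of_mul_le_mul_right hfin h

/-! ### Mollification and weakly harmonic functions -/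

/-- `h` is harmonic on `V` in the sense of distributions. -/
def WeaklyHarmonicOn (h : E n → ℝ) (V : Set (E n)) : Prop :=
  ∀ v : E n → ℝ, ContDiff ℝ ∞ v → HasCompactSupport v → tsupport v ⊆ V → ∫ x, h x * lap v x = 0

theorem WeaklyHarmonicOn.mono {h : E n → ℝ} {V W : Set (E n)} (hh : WeaklyHarmonicOn h W)
    (hVW : V ⊆ W) : WeaklyHarmonicOn h V :=
  fun v hv hc hs => hh v hv hc (hs.trans hVW)

/-- The convolution of two real-valued functions. -/
def conv (f h : E n → ℝ) : E n → ℝ :=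
  MeasureTheory.convolution f h (ContinuousLinearMap.lsmul ℝ ℝ) volume

theorem conv_apply (f h : E n → ℝ) (x : E n) : conv f h x = ∫ y, f (x - y) * h y :=
  convolution_lsmul_swap

theorem contDiff_conv {f h : E n → ℝ} (hf : ContDiff ℝ ∞ f) (hc : HasCompactSupport f)
    (hh : LocallyIntegrable h) : ContDiff ℝ ∞ (conv f h) :=
  hc.contDiff_convolution_left _ hf hh

theorem pd_conv {f h : E n → ℝ} (hf : ContDiff ℝ ∞ f) (hc : HasCompactSupport f)
    (hh : LocallyIntegrable h) (i : Fin n) : pd i (conv f h) = conv (pd i f) h := by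
  have h1 : ContDiff ℝ 1 f := by exact_mod_cast contDiff_infty.1 hf 1
  ext x
  have hd := hc.hasFDerivAt_convolution_left (ContinuousLinearMap.lsmul ℝ ℝ) h1 hh x
  have hex := (hc.fderiv (𝕜 := ℝ)).convolutionExists_left
    ((ContinuousLinearMap.lsmul ℝ ℝ).precompL (E n)) (h1.continuous_fderiv one_ne_zero) hh x
  unfold pd conv
  rw [hd.fderiv]
  unfold MeasureTheory.convolution
  rw [ContinuousLinearMap.integral_apply hex]
  rfl

theorem conv_integrable {f h : E n → ℝ} (hf : Continuous f) (hc : HasCompactSupport f)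
    (hh : LocallyIntegrable h) (x : E n) : Integrable fun y => f (x - y) * h y := by
  have h1 : HasCompactSupport fun y => f (x - y) := hc.comp_homeomorph (Homeomorph.subLeft x)
  have := hh.integrable_smul_left_of_hasCompactSupport
    (by fun_prop : Continuous fun y => f (x - y)) h1
  simpa [smul_eq_mul] using this

theorem lap_conv {f h : E n → ℝ} (hf : ContDiff ℝ ∞ f) (hc : HasCompactSupport f)
    (hh : LocallyIntegrable h) : lap (conv f h) = conv (lap f) h := by
  ext x
  have h2 : ∀ i, pd i (pd i (conv f h)) x = ∫ y, pd i (pd i f) (x - y) * h y := by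
    intro i
    rw [pd_conv hf hc hh, pd_conv (contDiff_pd hf i) (hasCompactSupport_pd hc i) hh, conv_apply]
  rw [conv_apply]
  simp only [lap, h2, Finset.sum_mul]
  rw [integral_finsetSum _ fun i _ => conv_integrable (contDiff_pd (contDiff_pd hf i) i).continuous
    (hasCompactSupport_pd (hasCompactSupport_pd hc i) i) hh x]

theorem lap_comp_sub_left {f : E n → ℝ} (hf : ContDiff ℝ ∞ f) (x : E n) :
    lap (fun y => f (x - y)) = fun y => lap f (x - y) := by
  have h1 : ∀ {g : E n → ℝ}, ContDiff ℝ ∞ g → ∀ i y,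
      pd i (fun y => g (x - y)) y = -pd i g (x - y) := by
    intro g hg i y
    have := (hg.differentiable (by simp) (x - y)).hasFDerivAt.comp y
      ((hasFDerivAt_id y).const_sub x)
    unfold pd
    rw [show (fun y => g (x - y)) = g ∘ (HSub.hSub x) from rfl, this.fderiv]
    simp
  have h2 : ∀ i, pd i (fun y => f (x - y)) = fun y => -pd i f (x - y) := fun i =>
    funext (h1 hf i)
  ext y
  simp only [lap, h2]
  refine Finset.sum_congr rfl fun i _ => ?_
  rw [h1 (g := fun z => -pd i f z) (contDiff_pd hf i).neg]
  change -fderiv ℝ (fun z => -pd i f z) (x - y) _ = _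
  simp [pd_eq_dirDeriv i (pd i f), dirDeriv, fderiv_fun_neg]

/-- The Laplacian of the mollification at $x$ is $h$ paired with the Laplacian of the test function
$y\mapsto f(x-y)$, supported within $\eta$ of $x$. -/
theorem lap_conv_eq_zero {f h : E n → ℝ} (hf : ContDiff ℝ ∞ f) (hc : HasCompactSupport f)
    (hh : LocallyIntegrable h) {V : Set (E n)} (hw : WeaklyHarmonicOn h V) {η : ℝ}
    (hs : tsupport f ⊆ Metric.closedBall 0 η) {x : E n} (hx : Metric.closedBall x η ⊆ V) :
    lap (conv f h) x = 0 := by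
  rw [lap_conv hf hc hh, conv_apply]
  have h1 := hw (fun y => f (x - y)) (hf.comp (contDiff_const.sub contDiff_id))
    (hc.comp_homeomorph (Homeomorph.subLeft x)) ?_
  · rw [lap_comp_sub_left hf] at h1
    simpa only [mul_comm] using h1
  · refine (closure_minimal ?_ Metric.isClosed_closedBall).trans hx
    intro y hy
    have := hs (subset_tsupport f hy)
    simpa [dist_eq_norm, norm_sub_rev] using this

/-- Jensen's inequality, read off from the nonnegativity of the variance of $h$ under the density
$f(x-\cdot)$. -/
theorem sq_conv_le {f h : E n → ℝ} (hf : Continuous f) (hc : HasCompactSupport f)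
    (hf0 : ∀ x, 0 ≤ f x) (hf1 : ∫ x, f x = 1) (hh : LocallyIntegrable h)
    (hh2 : LocallyIntegrable fun x => h x ^ 2) (x : E n) :
    conv f h x ^ 2 ≤ conv f (fun y => h y ^ 2) x := by
  have i1 := conv_integrable hf hc hh x
  have i2 := conv_integrable hf hc hh2 x
  have i0 : Integrable fun y => f (x - y) := (hf.integrable_of_hasCompactSupport hc).comp_sub_left x
  have e0 : ∫ y, f (x - y) = 1 := by rw [integral_sub_left_eq_self, hf1]
  set m := conv f h x with hm
  have hm' : ∫ y, f (x - y) * h y = m := (conv_apply f h x).symm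
  have h0 : 0 ≤ ∫ y, f (x - y) * (h y - m) ^ 2 :=
    integral_nonneg fun y => mul_nonneg (hf0 _) (sq_nonneg _)
  have h1 : ∫ y, f (x - y) * (h y - m) ^ 2
      = ∫ y, (f (x - y) * h y ^ 2 - 2 * m * (f (x - y) * h y) + m ^ 2 * f (x - y)) :=
    integral_congr_ae (Filter.Eventually.of_forall fun y => by ring)
  have i3 : Integrable fun y => f (x - y) * h y ^ 2 - 2 * m * (f (x - y) * h y) :=
    i2.sub (i1.const_mul _)
  rw [h1, integral_add i3 (i0.const_mul _), integral_sub i2 (i1.const_mul _), integral_const_mul, integral_const_mul, hm', e0] at h0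
  rw [conv_apply]
  nlinarith

theorem memLp_two_locallyIntegrable {h : E n → ℝ} (hh : MemLp h 2) : LocallyIntegrable h :=
  hh.locallyIntegrable (by norm_num)

theorem l2norm_conv_le {f h : E n → ℝ} (hf : ContDiff ℝ ∞ f) (hc : HasCompactSupport f)
    (hf0 : ∀ x, 0 ≤ f x) (hf1 : ∫ x, f x = 1) (hh : MemLp h 2) {η : ℝ}
    (hs : Function.support f ⊆ Metric.ball 0 η) (c : E n) {r s : ℝ} (hrs : r + η ≤ s) :
    l2norm (Metric.ball c r) (conv f h) ≤ l2norm (Metric.ball c s) h := by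
  have hloc := memLp_two_locallyIntegrable hh
  have hsq : Integrable fun x => h x ^ 2 := hh.integrable_sq
  -- Cutting $h^2$ off outside the larger ball does not change its mollification on the smaller one,
  -- and makes the total integral the desired bound.
  set k : E n → ℝ := (Metric.ball c s).indicator fun x => h x ^ 2 with hk
  have hki : Integrable k := hsq.indicator Metric.isOpen_ball.measurableSet
  have hfi : Integrable f := hf.continuous.integrable_of_hasCompactSupport hc
  have hck : Integrable (conv f k) := hfi.integrable_convolution _ hki
  have hik : ∫ x, conv f k x = ∫ x in Metric.ball c s, h x ^ 2 := by
    have := integral_convolution (ContinuousLinearMap.lsmul ℝ ℝ) (μ := volume) hfi hki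
    unfold conv
    rw [this, hf1, hk, integral_indicator Metric.isOpen_ball.measurableSet]
    simp
  refine Real.sqrt_le_sqrt ?_
  rw [← hik]
  have hnn : ∀ x, 0 ≤ conv f k x := by
    intro x
    rw [conv_apply]
    exact integral_nonneg fun y => mul_nonneg (hf0 _) (indicator_nonneg (fun _ _ => sq_nonneg _) _)
  refine le_trans ?_ (setIntegral_le_integral (s := Metric.ball c r) hck
    (Filter.Eventually.of_forall hnn))
  refine setIntegral_mono_on (integrableOn_ball_of_continuous
    ((contDiff_conv hf hc hloc).continuous.pow 2) c r) hck.integrableOn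
    Metric.isOpen_ball.measurableSet fun x hx => ?_
  refine (sq_conv_le hf.continuous hc hf0 hf1 hloc hsq.locallyIntegrable x).trans (le_of_eq ?_)
  rw [conv_apply, conv_apply]
  refine integral_congr_ae (Filter.Eventually.of_forall fun y => ?_)
  by_cases hy : f (x - y) = 0
  · simp [hy]
  · have h1 := hs hy
    have h2 : y ∈ Metric.ball c s := by
      rw [Metric.mem_ball] at hx ⊢
      rw [mem_ball_zero_iff, ← dist_eq_norm] at h1
      have := dist_triangle y x c
      rw [dist_comm y x] at this
      linarith
    simp [hk, h2]

theorem eLpNorm_eq_l2norm {S : Set (E n)} {f : E n → ℝ} (hf : MemLp f 2 (volume.restrict S)) :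
    eLpNorm f 2 (volume.restrict S) = ENNReal.ofReal (l2norm S f) := by
  rw [hf.eLpNorm_eq_integral_rpow_norm (by norm_num) (by norm_num)]
  simp only [ENNReal.toReal_ofNat, Real.norm_eq_abs, Real.rpow_two, sq_abs, l2norm,
    Real.sqrt_eq_rpow, one_div]

theorem l2norm_mono {f : E n → ℝ} (hf : MemLp f 2) {S T : Set (E n)} (h : S ⊆ T) :
    l2norm S f ≤ l2norm T f :=
  Real.sqrt_le_sqrt (setIntegral_mono_set hf.integrable_sq.integrableOn
    (Filter.Eventually.of_forall fun _ => sq_nonneg _) h.eventuallyLE)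

/-- Propagation of smallness for weakly harmonic functions from a small ball around `c` to a ball
around the nearby point `c + e`. -/
theorem l2norm_propagation {h : E n → ℝ} (hh : MemLp h 2) {c e : E n} {r ρ : ℝ}
    (hr : 0 < r) (hrρ : r ≤ ρ / 12) (he : ‖e‖ ≤ ρ / 12)
    (hw : WeaklyHarmonicOn h (Metric.ball (c + e) (2 * ρ))) (N : ℕ) :
    l2norm (Metric.ball (c + e) r) h
      ≤ (∑ k ∈ Finset.range N, (3 * ‖e‖ / r) ^ k) * l2norm (Metric.ball c (3 * r)) h
        + (1 / 2) ^ N * l2norm univ h := by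
  have hloc := memLp_two_locallyIntegrable hh
  -- All radii are at most $r$, so mollification enlarges balls by at most $r$: hence $3r$ and
  -- $2\rho$ in place of the $2r$ and $\rho$ of the smooth case.
  let φ : ℕ → ContDiffBump (0 : E n) := fun j =>
    { rIn := r / (j + 1) / 2
      rOut := r / (j + 1)
      rIn_pos := by positivity
      rIn_lt_rOut := half_lt_self (by positivity) }
  have hout : ∀ j, (φ j).rOut ≤ r := fun j =>
    div_le_self hr.le (by have : (0 : ℝ) ≤ j := by positivity
                          linarith)
  set f : ℕ → E n → ℝ := fun j => (φ j).normed volume with hf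
  have hfs : ∀ j, ContDiff ℝ ∞ (f j) := fun j => (φ j).contDiff_normed
  have hfc : ∀ j, HasCompactSupport (f j) := fun j => (φ j).hasCompactSupport_normed
  have hf0 : ∀ j x, 0 ≤ f j x := fun j => (φ j).nonneg_normed
  have hf1 : ∀ j, ∫ x, f j x = 1 := fun j => (φ j).integral_normed
  have hsupp : ∀ j, Function.support (f j) ⊆ Metric.ball 0 r := fun j => by
    rw [hf, (φ j).support_normed_eq]
    exact Metric.ball_subset_ball (hout j)
  have htsupp : ∀ j, tsupport (f j) ⊆ Metric.closedBall 0 r := fun j => by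
    rw [hf, (φ j).tsupport_normed_eq]
    exact Metric.closedBall_subset_closedBall (hout j)
  have hA0 : 0 ≤ ∑ k ∈ Finset.range N, (3 * ‖e‖ / r) ^ k :=
    Finset.sum_nonneg fun k _ => by positivity
  have hbound : ∀ j, l2norm (Metric.ball (c + e) r) (conv (f j) h)
      ≤ (∑ k ∈ Finset.range N, (3 * ‖e‖ / r) ^ k) * l2norm (Metric.ball c (3 * r)) h
        + (1 / 2) ^ N * l2norm univ h := by
    intro j
    refine (l2norm_propagation_smooth (contDiff_conv (hfs j) (hfc j) hloc) hr hrρ he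
      (fun x hx => lap_conv_eq_zero (hfs j) (hfc j) hloc hw (htsupp j) ?_) N).trans ?_
    · refine Metric.closedBall_subset_ball' ?_
      rw [Metric.mem_ball] at hx
      linarith
    · have h1 := l2norm_conv_le (hfs j) (hfc j) (hf0 j) (hf1 j) hh (hsupp j) c
        (show 2 * r + r ≤ 3 * r by linarith)
      have h2 := (l2norm_conv_le (hfs j) (hfc j) (hf0 j) (hf1 j) hh (hsupp j) (c + e)
        (le_refl (ρ + r))).trans (l2norm_mono hh (subset_univ _))
      gcongr
  have hlim : ∀ᵐ x ∂(volume.restrict (Metric.ball (c + e) r)),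
      Filter.Tendsto (fun j => conv (f j) h x) Filter.atTop (nhds (h x)) := by
    refine ae_restrict_of_ae ?_
    refine ContDiffBump.ae_convolution_tendsto_right_of_locallyIntegrable (φ := φ) (K := 2)
      ?_ (Filter.Eventually.of_forall fun j => ?_) hloc
    · exact tendsto_const_nhds.div_atTop
        (tendsto_natCast_atTop_atTop.atTop_add tendsto_const_nhds)
    · change r / (j + 1) ≤ 2 * (r / (j + 1) / 2)
      linarith
  -- The bound is uniform in $j$ and passes to the a.e. limit by Fatou's lemma.
  have hfatou := Lp.eLpNorm_lim_le_liminf_eLpNorm (p := 2)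
    (fun j => (contDiff_conv (hfs j) (hfc j) hloc).continuous.aestronglyMeasurable) h hlim
  rw [eLpNorm_eq_l2norm (hh.restrict _)] at hfatou
  have hnn : 0 ≤ (∑ k ∈ Finset.range N, (3 * ‖e‖ / r) ^ k) * l2norm (Metric.ball c (3 * r)) h
      + (1 / 2) ^ N * l2norm univ h := (l2norm_nonneg _ _).trans (hbound 0)
  refine (ENNReal.ofReal_le_ofReal_iff hnn).1 (hfatou.trans
    (Filter.liminf_le_of_le (f := Filter.atTop) (h := fun b hb => ?_)))
  obtain ⟨j, hj⟩ := hb.exists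
  refine hj.trans ?_
  rw [eLpNorm_eq_l2norm (memLp_two_of_continuous
    (contDiff_conv (hfs j) (hfc j) hloc).continuous _ _)]
  exact ENNReal.ofReal_le_ofReal (hbound j)

/-! ### Quantitative unique continuation along chains of balls -/

/-- A quantitative unique continuation estimate from `D` to `S`, uniform over the square integrable
functions that are weakly harmonic on `W`. The parameter `t` interpolates between the two terms. -/
def Controls (W D S : Set (E n)) (k : ℕ) (C A : ℝ) : Prop :=
  ∀ h : E n → ℝ, MemLp h 2 → WeaklyHarmonicOn h W → ∀ t : ℝ, 0 < t → t ≤ 1 →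
    t ^ k * l2norm S h ≤ C * l2norm D h + A * t ^ (k + 1) * l2norm univ h

theorem Controls.mono {W D S S' : Set (E n)} {k : ℕ} {C A : ℝ} (h : Controls W D S k C A)
    (hS : S' ⊆ S) : Controls W D S' k C A := fun f hf hw t ht ht1 =>
  (mul_le_mul_of_nonneg_left (l2norm_mono hf hS) (by positivity)).trans (h f hf hw t ht ht1)

theorem geom_sum_le_pow {a : ℝ} (ha : 0 ≤ a) (N : ℕ) :
    ∑ k ∈ Finset.range N, a ^ k ≤ (a + 2) ^ N := by
  induction N with
  | zero => simp
  | succ N ih =>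
    rw [Finset.sum_range_succ, pow_succ]
    have h1 : a ^ N ≤ (a + 2) ^ N := pow_le_pow_left₀ ha (by linarith) N
    have h2 : 0 ≤ (a + 2) ^ N := by positivity
    nlinarith

/-- The geometric sum grows at most like $2^{mN}$ once $a+2<2^m$. Choosing the order $N+1$ with
$2^{-(N+1)}<s\le2^{-N}$ turns this growth into $s^{-m}$ and the remainder into a factor $s$. -/
theorem exists_interpolation {a : ℝ} (ha : 0 ≤ a) :
    ∃ m : ℕ, ∀ L δ M : ℝ, 0 ≤ L → 0 ≤ δ → 0 ≤ M →
      (∀ N : ℕ, L ≤ (∑ k ∈ Finset.range N, a ^ k) * δ + (1 / 2) ^ N * M) →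
      ∀ s : ℝ, 0 < s → s ≤ 1 → s ^ m * L ≤ 2 ^ m * δ + s ^ (m + 1) * M := by
  obtain ⟨m, hm⟩ := pow_unbounded_of_one_lt (a + 2) (one_lt_two)
  refine ⟨m, fun L δ M hL hδ hM h s hs hs1 => ?_⟩
  obtain ⟨N, hN1, hN2⟩ := exists_nat_pow_near_of_lt_one hs hs1 (y := (1 / 2 : ℝ))
    (by norm_num) (by norm_num)
  have h1 : ∑ k ∈ Finset.range (N + 1), a ^ k ≤ (2 ^ (N + 1)) ^ m := by
    refine (geom_sum_le_pow ha _).trans ?_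
    rw [← pow_mul, mul_comm, pow_mul]
    exact pow_le_pow_left₀ (by linarith) hm.le _
  have h2 : s * 2 ^ (N + 1) ≤ 2 := by
    calc s * 2 ^ (N + 1) ≤ (1 / 2) ^ N * 2 ^ (N + 1) := by gcongr
      _ = 2 := by rw [pow_succ, ← mul_assoc, ← mul_pow]; norm_num
  have h3 : s ^ m * (∑ k ∈ Finset.range (N + 1), a ^ k) ≤ 2 ^ m := by
    calc s ^ m * (∑ k ∈ Finset.range (N + 1), a ^ k) ≤ s ^ m * (2 ^ (N + 1)) ^ m := by gcongr
      _ = (s * 2 ^ (N + 1)) ^ m := by rw [mul_pow]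
      _ ≤ 2 ^ m := by gcongr
  calc s ^ m * L ≤ s ^ m * ((∑ k ∈ Finset.range (N + 1), a ^ k) * δ + (1 / 2) ^ (N + 1) * M) := by
        gcongr; exact h _
    _ = s ^ m * (∑ k ∈ Finset.range (N + 1), a ^ k) * δ + s ^ m * (1 / 2) ^ (N + 1) * M := by ring
    _ ≤ 2 ^ m * δ + s ^ m * s * M := by gcongr
    _ = _ := by ring

/-- The new radius shrinks with $r_0$, but the admissible length of $e$ depends only on $\rho$; this
is what makes the set of reachable points relatively closed. -/
theorem controls_step {W D : Set (E n)} {c e : E n} {ρ r₀ : ℝ} (hr₀ : 0 < r₀) (hρ : 0 < ρ)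
    (he : ‖e‖ ≤ ρ / 12) (hW : Metric.ball (c + e) (2 * ρ) ⊆ W) {k : ℕ} {C : ℝ} (hC : 0 ≤ C)
    (hc : Controls W D (Metric.ball c r₀) k C 1) :
    ∃ r : ℝ, 0 < r ∧ ∃ k' : ℕ, ∃ C' : ℝ, 0 ≤ C' ∧
      Controls W D (Metric.ball (c + e) r) k' C' 1 := by
  set r := min (r₀ / 3) (ρ / 12) with hr
  have hr0 : 0 < r := by positivity
  obtain ⟨m, hm⟩ := exists_interpolation (a := 3 * ‖e‖ / r) (by positivity)
  set κ : ℝ := (2 ^ (2 * m + 1)) ^ k * 2 ^ m with hκ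
  refine ⟨r, hr0, (m + 1) * k + m, κ * (2 ^ m * C), by positivity, fun h hh hw t ht ht1 => ?_⟩
  set L := l2norm (Metric.ball (c + e) r) h
  set δ := l2norm (Metric.ball c r₀) h
  set d := l2norm D h
  set M := l2norm univ h
  have hL0 : 0 ≤ L := l2norm_nonneg _ _
  have hδ0 : 0 ≤ δ := l2norm_nonneg _ _
  have hM0 : 0 ≤ M := l2norm_nonneg _ _
  have hN : ∀ N : ℕ, L ≤ (∑ k ∈ Finset.range N, (3 * ‖e‖ / r) ^ k) * δ + (1 / 2) ^ N * M := by
    intro N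
    refine (l2norm_propagation hh hr0 (min_le_right _ _) he (hw.mono hW) N).trans ?_
    have h1 : l2norm (Metric.ball c (3 * r)) h ≤ δ :=
      l2norm_mono hh (Metric.ball_subset_ball (by linarith [min_le_left (r₀ / 3) (ρ / 12)]))
    have h2 : 0 ≤ ∑ k ∈ Finset.range N, (3 * ‖e‖ / r) ^ k :=
      Finset.sum_nonneg fun k _ => by positivity
    gcongr
  have h1 := hm L δ M hL0 hδ0 hM0 hN (t / 2) (by positivity) (by linarith)
  -- This $\tau$ makes the inherited error $2^m\tau$ equal to the new one, $(t/2)^{m+1}$. Their sum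
  -- is $t\,(t/2)^m$, so the constant in front of the global norm stays $1$; $\kappa$ then restores
  -- pure powers of $t$.
  set τ := (t / 2) ^ (m + 1) / 2 ^ m with hτ
  have hτ0 : 0 < τ := by positivity
  have hτ1 : τ ≤ 1 := by
    rw [hτ, div_le_one (by positivity)]
    exact (pow_le_one₀ (by positivity) (by linarith)).trans (one_le_pow₀ one_le_two)
  have h2 := hc h hh hw τ hτ0 hτ1
  have e1 : (2 : ℝ) ^ m * τ = (t / 2) ^ (m + 1) := by rw [hτ]; field_simp
  have h3 : τ ^ k * (t / 2) ^ m * L ≤ 2 ^ m * C * d + τ ^ k * (t / 2) ^ m * t * M := by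
    calc τ ^ k * (t / 2) ^ m * L = τ ^ k * ((t / 2) ^ m * L) := by ring
      _ ≤ τ ^ k * (2 ^ m * δ + (t / 2) ^ (m + 1) * M) := by gcongr
      _ = 2 ^ m * (τ ^ k * δ) + τ ^ k * (t / 2) ^ (m + 1) * M := by ring
      _ ≤ 2 ^ m * (C * d + 1 * τ ^ (k + 1) * M) + τ ^ k * (t / 2) ^ (m + 1) * M := by gcongr
      _ = 2 ^ m * C * d + τ ^ k * (2 ^ m * τ) * M + τ ^ k * (t / 2) ^ (m + 1) * M := by ring
      _ = _ := by rw [e1]; ring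
  have e2 : κ * (τ ^ k * (t / 2) ^ m) = t ^ ((m + 1) * k + m) := by
    have : (2 : ℝ) ^ (2 * m + 1) * τ = t ^ (m + 1) := by
      rw [show (2 : ℝ) ^ (2 * m + 1) * τ = 2 ^ (m + 1) * (2 ^ m * τ) by ring, e1, ← mul_pow]
      congr 1; ring
    calc κ * (τ ^ k * (t / 2) ^ m) = (2 ^ (2 * m + 1) * τ) ^ k * (2 * (t / 2)) ^ m := by
          rw [hκ, mul_pow, mul_pow]; ring
      _ = _ := by rw [this, pow_add t ((m + 1) * k), pow_mul, mul_div_cancel₀ t two_ne_zero]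
  have h4 := mul_le_mul_of_nonneg_left h3 (by positivity : 0 ≤ κ)
  calc t ^ ((m + 1) * k + m) * L = κ * (τ ^ k * (t / 2) ^ m * L) := by rw [← e2]; ring
    _ ≤ _ := h4
    _ = κ * (2 ^ m * C) * d + κ * (τ ^ k * (t / 2) ^ m) * t * M := by ring
    _ = _ := by rw [e2]; ring

/-- Smallness on a ball propagates to a neighbourhood of each point of a connected open set. -/
theorem exists_controls_ball {W : Set (E n)} (hWo : IsOpen W) (hWc : IsPreconnected W) {b : E n}
    {rb : ℝ} (hrb : 0 < rb) (hb : b ∈ W) {y : E n} (hy : y ∈ W) :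
    ∃ r : ℝ, 0 < r ∧ ∃ k : ℕ, ∃ C : ℝ, 0 ≤ C ∧
      Controls W (Metric.ball b rb) (Metric.ball y r) k C 1 := by
  set u : Set (E n) := {y | y ∈ W ∧ ∃ r : ℝ, 0 < r ∧ ∃ k : ℕ, ∃ C : ℝ, 0 ≤ C ∧
      Controls W (Metric.ball b rb) (Metric.ball y r) k C 1} with hu
  have huo : IsOpen u := by
    rw [Metric.isOpen_iff]
    rintro y ⟨hyW, r, hr, k, C, hC, h⟩
    obtain ⟨ε, hε, hεW⟩ := Metric.isOpen_iff.1 hWo y hyW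
    refine ⟨min ε (r / 2), by positivity, fun z hz => ⟨hεW ?_, r / 2, by positivity, k, C, hC,
      h.mono (Metric.ball_subset_ball' ?_)⟩⟩
    · exact Metric.ball_subset_ball (min_le_left _ _) hz
    · have := (Metric.mem_ball.1 hz).trans_le (min_le_right _ _)
      linarith
  have hbu : b ∈ u := by
    refine ⟨hb, rb, hrb, 0, 1, zero_le_one, fun h hh hw t ht ht1 => ?_⟩
    have := l2norm_nonneg univ h
    simp only [pow_zero, one_mul, zero_add, pow_one]
    have : 0 ≤ t * l2norm univ h := by positivity
    linarith
  -- By connectedness it suffices that the reachable set is also relatively closed in $W$: a limit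
  -- point $z$ is reached from some $c$ within $\rho/12$, where $\rho=\varepsilon/2$ is fixed by $z$
  -- alone.
  refine (hWc.subset_of_closure_inter_subset huo ⟨b, hb, hbu⟩ ?_ hy).2
  rintro z ⟨hzu, hzW⟩
  obtain ⟨ε, hε, hεW⟩ := Metric.isOpen_iff.1 hWo z hzW
  obtain ⟨c, ⟨hcW, r, hr, k, C, hC, h⟩, hcz⟩ := Metric.mem_closure_iff.1 hzu (ε / 2 / 12)
    (by positivity)
  have := controls_step (c := c) (e := z - c) (ρ := ε / 2) hr (by positivity)
    (by rw [← dist_eq_norm]; exact hcz.le) (by simpa [mul_div_cancel₀] using hεW) hC h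
  rw [add_sub_cancel] at this
  exact ⟨hzW, this⟩

theorem l2norm_union_le {h : E n → ℝ} (hh : MemLp h 2) (S T : Set (E n)) :
    l2norm (S ∪ T) h ≤ l2norm S h + l2norm T h := by
  refine Real.sqrt_le_iff.2 ⟨add_nonneg (l2norm_nonneg _ _) (l2norm_nonneg _ _), ?_⟩
  have hi := hh.integrable_sq
  have h1 : ∫ x in S ∪ T, h x ^ 2 ≤ (∫ x in S, h x ^ 2) + ∫ x in T, h x ^ 2 := by
    rw [← integral_add_measure hi.integrableOn hi.integrableOn]
    exact integral_mono_measure (Measure.restrict_union_le S T)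
      (Filter.Eventually.of_forall fun _ => sq_nonneg _)
      (hi.integrableOn.integrable.add_measure hi.integrableOn.integrable)
  rw [← l2norm_sq S, ← l2norm_sq T] at h1
  nlinarith [mul_nonneg (l2norm_nonneg S h) (l2norm_nonneg T h)]

/-- Because $t\le1$, the exponent may be increased; this brings finitely many estimates to a common
exponent. -/
theorem Controls.raise {W D S : Set (E n)} {k : ℕ} {C A : ℝ} (hC : 0 ≤ C)
    (h : Controls W D S k C A) (j : ℕ) : Controls W D S (k + j) C A := by
  intro f hf hw t ht ht1
  have h1 := mul_le_mul_of_nonneg_left (h f hf hw t ht ht1) (by positivity : 0 ≤ t ^ j)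
  have h2 : t ^ j * (C * l2norm D f) ≤ 1 * (C * l2norm D f) :=
    mul_le_mul_of_nonneg_right (pow_le_one₀ ht.le ht1) (mul_nonneg hC (l2norm_nonneg _ _))
  calc t ^ (k + j) * l2norm S f = t ^ j * (t ^ k * l2norm S f) := by ring
    _ ≤ _ := h1
    _ = t ^ j * (C * l2norm D f) + A * t ^ (k + j + 1) * l2norm univ f := by ring
    _ ≤ _ := by linarith

theorem exists_controls_isCompact {W : Set (E n)} (hWo : IsOpen W) (hWc : IsPreconnected W)
    {b : E n} {rb : ℝ} (hrb : 0 < rb) (hb : b ∈ W) {K : Set (E n)} (hK : IsCompact K)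
    (hKW : K ⊆ W) :
    ∃ k : ℕ, ∃ C A : ℝ, 0 ≤ C ∧ 0 ≤ A ∧ Controls W (Metric.ball b rb) K k C A := by
  refine hK.induction_on (p := fun K => ∃ k : ℕ, ∃ C A : ℝ, 0 ≤ C ∧ 0 ≤ A ∧
    Controls W (Metric.ball b rb) K k C A) ?_ ?_ ?_ ?_
  · refine ⟨0, 0, 0, le_rfl, le_rfl, fun h hh hw t ht ht1 => ?_⟩
    simp [l2norm]
  · rintro S T hST ⟨k, C, A, hC, hA, h⟩
    exact ⟨k, C, A, hC, hA, h.mono hST⟩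
  · rintro S T ⟨k, C, A, hC, hA, h⟩ ⟨k', C', A', hC', hA', h'⟩
    refine ⟨k + k', C + C', A + A', by positivity, by positivity, fun f hf hw t ht ht1 => ?_⟩
    have h1 := h.raise hC k' f hf hw t ht ht1
    have h2 := h'.raise hC' k f hf hw t ht ht1
    rw [add_comm k' k] at h2
    have h3 := mul_le_mul_of_nonneg_left (l2norm_union_le hf S T)
      (by positivity : 0 ≤ t ^ (k + k'))
    linarith
  · intro y hy
    obtain ⟨r, hr, k, C, hC, h⟩ := exists_controls_ball hWo hWc hrb hb (hKW hy)
    exact ⟨Metric.ball y r, mem_nhdsWithin_of_mem_nhds (Metric.ball_mem_nhds y hr), k, C, 1, hC,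
      zero_le_one, h⟩

/-! ### Splitting off a weakly harmonic part -/

theorem lap_add {v w : E n → ℝ} (hv : ContDiff ℝ ∞ v) (hw : ContDiff ℝ ∞ w) :
    lap (v + w) = lap v + lap w := by
  have h : ∀ {f g : E n → ℝ}, ContDiff ℝ ∞ f → ContDiff ℝ ∞ g → ∀ i,
      pd i (f + g) = pd i f + pd i g := by
    intro f g hf hg i
    ext x
    simp [pd, fderiv_add (hf.differentiable (by simp) x) (hg.differentiable (by simp) x)]
  ext x
  simp only [lap, h hv hw, h (contDiff_pd hv _) (contDiff_pd hw _), Pi.add_apply,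
    Finset.sum_add_distrib]

theorem lap_const_smul {v : E n → ℝ} (hv : ContDiff ℝ ∞ v) (a : ℝ) :
    lap (a • v) = a • lap v := by
  have h : ∀ {f : E n → ℝ}, ContDiff ℝ ∞ f → ∀ i, pd i (a • f) = a • pd i f := by
    intro f hf i
    ext x
    simp [pd, fderiv_const_smul (hf.differentiable (by simp) x)]
  ext x
  simp only [lap, h hv, h (contDiff_pd hv _), Pi.smul_apply, Finset.smul_sum]

theorem lap_zero : lap (0 : E n → ℝ) = 0 := by
  simpa using lap_const_smul (n := n) (v := 0) contDiff_const 0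

theorem memLp_lap {v : E n → ℝ} (hv : ContDiff ℝ ∞ v) (hc : HasCompactSupport v) :
    MemLp (lap v) 2 :=
  (contDiff_lap hv).continuous.memLp_of_hasCompactSupport (hasCompactSupport_lap hc)

/-- The Laplacians of the test functions on `W`, as a subspace of `L₂`. -/
def laplacianRange (W : Set (E n)) : Submodule ℝ (Lp ℝ 2 (volume : Measure (E n))) where
  carrier := {f | ∃ v : E n → ℝ, ContDiff ℝ ∞ v ∧ HasCompactSupport v ∧ tsupport v ⊆ W ∧
    f =ᵐ[volume] lap v}
  add_mem' := by
    rintro f g ⟨v, hv, hvc, hvs, hf⟩ ⟨w, hw, hwc, hws, hg⟩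
    refine ⟨v + w, hv.add hw, hvc.add hwc, (tsupport_add v w).trans (union_subset hvs hws), ?_⟩
    rw [lap_add hv hw]
    exact (Lp.coeFn_add f g).trans (hf.add hg)
  zero_mem' := by
    refine ⟨0, contDiff_const, HasCompactSupport.zero, by simp [tsupport], ?_⟩
    rw [lap_zero]
    exact Lp.coeFn_zero _ _ _
  smul_mem' := by
    rintro a f ⟨v, hv, hvc, hvs, hf⟩
    refine ⟨a • v, hv.const_smul a, hvc.smul_left (f := fun _ => a),
      (closure_mono (Function.support_const_smul_subset a v)).trans hvs, ?_⟩
    rw [lap_const_smul hv]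
    exact (Lp.coeFn_smul a f).trans (hf.const_smul a)

theorem norm_Lp_eq_l2norm (f : Lp ℝ 2 (volume : Measure (E n))) : ‖f‖ = l2norm univ f := by
  have h := eLpNorm_eq_l2norm (S := univ) (f := f) (by simpa using Lp.memLp f)
  rw [Measure.restrict_univ] at h
  rw [Lp.norm_def, h, ENNReal.toReal_ofReal (l2norm_nonneg _ _)]

theorem l2norm_congr_ae {S : Set (E n)} {f g : E n → ℝ} (h : f =ᵐ[volume] g) :
    l2norm S f = l2norm S g := by
  unfold l2norm
  congr 1
  refine integral_congr_ae (ae_restrict_of_ae ?_)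
  filter_upwards [h] with x hx
  rw [hx]

/-- A square integrable function whose distributional Laplacian on `W` is small is the sum of a
weakly harmonic and a small function. -/
theorem exists_weaklyHarmonic_decomposition {W : Set (E n)} {z : E n → ℝ} (hz : MemLp z 2) {K : ℝ}
    (hK0 : 0 ≤ K)
    (hK : ∀ v : E n → ℝ, ContDiff ℝ ∞ v → HasCompactSupport v → tsupport v ⊆ W →
      |∫ x, z x * lap v x| ≤ K * l2norm univ (lap v)) :
    ∃ w : E n → ℝ, MemLp w 2 ∧ l2norm univ w ≤ K ∧ WeaklyHarmonicOn (z - w) W := by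
  set Z : Lp ℝ 2 (volume : Measure (E n)) := hz.toLp z with hZ
  have hZz : Z =ᵐ[volume] z := hz.coeFn_toLp
  set U := (laplacianRange W).topologicalClosure with hU
  have : CompleteSpace U := (laplacianRange W).isClosed_topologicalClosure.completeSpace_coe
  -- Orthogonality to all Laplacians of test functions on $W$ is precisely weak harmonicity on $W$.
  obtain ⟨w, hw, h, hh, hsum⟩ := Submodule.exists_add_mem_mem_orthogonal (K := U) Z
  rw [Submodule.mem_orthogonal] at hh
  have hbound : ∀ f ∈ U, |inner ℝ f Z| ≤ K * ‖f‖ := by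
    intro f hf
    have hcl : IsClosed {f : Lp ℝ 2 (volume : Measure (E n)) | |inner ℝ f Z| ≤ K * ‖f‖} :=
      isClosed_le (by fun_prop) (by fun_prop)
    refine closure_minimal ?_ hcl hf
    rintro g ⟨v, hv, hvc, hvs, hg⟩
    rw [mem_ofPred_eq, norm_Lp_eq_l2norm, l2norm_congr_ae hg, L2.inner_def]
    refine le_trans (le_of_eq ?_) (hK v hv hvc hvs)
    congr 1
    refine integral_congr_ae ?_
    filter_upwards [hg, hZz] with x h1 h2
    simp [h1, h2]
  -- Here $\|w\|^2=\langle w,Z\rangle\le K\|w\|$, by orthogonality of the two summands.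
  have hwn : ‖w‖ ≤ K := by
    have h1 := (abs_le.1 (hbound w hw)).2
    rw [hsum, inner_add_right, hh w hw, add_zero, real_inner_self_eq_norm_sq] at h1
    rcases (norm_nonneg w).eq_or_lt with h0 | h0
    · rw [← h0]; exact hK0
    · rw [sq] at h1
      exact le_of_mul_le_mul_right h1 h0
  refine ⟨w, Lp.memLp w, by rwa [← norm_Lp_eq_l2norm], fun v hv hvc hvs => ?_⟩
  have hm := memLp_lap hv hvc
  have h1 := hh (hm.toLp _) ((laplacianRange W).le_topologicalClosure
    ⟨v, hv, hvc, hvs, hm.coeFn_toLp⟩)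
  rw [L2.inner_def] at h1
  rw [← h1]
  refine integral_congr_ae ?_
  have h2 : h = Z - w := by rw [hsum, add_sub_cancel_left]
  filter_upwards [hm.coeFn_toLp, Lp.coeFn_sub Z w, hZz] with x e1 e2 e3
  rw [h2, e1, e2]
  simp [e3]

/-! ### From the parameter $t$ to a Hölder estimate -/

/-- The choice $t=(\varepsilon/H)^{1/(k+1)}$ balances the two terms and is at most $1$ since
$\varepsilon\le H$. For $\varepsilon=0$ small $t$ forces $L\le0$. -/
theorem le_rpow_of_forall_interpolation {L ε H Q : ℝ} {k : ℕ} (hε : 0 ≤ ε)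
    (hH : ε ≤ H)
    (h : ∀ t : ℝ, 0 < t → t ≤ 1 → t ^ k * L ≤ Q * (ε + t ^ (k + 1) * H)) :
    L ≤ 2 * Q * ε ^ (1 / ((k : ℝ) + 1)) * H ^ (1 - 1 / ((k : ℝ) + 1)) := by
  have hk : (0 : ℝ) < k + 1 := by positivity
  rcases hε.eq_or_lt with rfl | hε0
  · rw [Real.zero_rpow (by positivity), mul_zero, zero_mul]
    have h1 : ∀ t : ℝ, 0 < t → t ≤ 1 → L ≤ Q * H * t := by
      intro t ht ht1
      have := h t ht ht1
      have e : Q * (0 + t ^ (k + 1) * H) = t ^ k * (Q * H * t) := by ring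
      rw [e] at this
      exact le_of_mul_le_mul_left this (by positivity)
    by_contra hL
    push Not at hL
    have h2 := h1 1 one_pos le_rfl
    rw [mul_one] at h2
    have hQH : 0 < Q * H := hL.trans_le h2
    -- This value of $t$ gives $L\le L/2$, contradicting $L>0$.
    have h3 := h1 (L / (2 * (Q * H))) (by positivity) (by rw [div_le_one (by positivity)]; linarith)
    have h4 : Q * H * (L / (2 * (Q * H))) = L / 2 := by
      rw [mul_div_assoc', mul_comm 2, mul_div_mul_left _ _ hQH.ne']
    linarith
  · have hH0 : 0 < H := hε0.trans_le hH
    set s : ℝ := 1 / ((k : ℝ) + 1) with hs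
    have hs0 : 0 < s := by positivity
    set a := ε ^ s with ha
    set b := H ^ s with hb
    have ha0 : 0 < a := by positivity
    have hb0 : 0 < b := by positivity
    have hab : a ≤ b := Real.rpow_le_rpow hε hH hs0.le
    have hsk : s * (k + 1) = 1 := by rw [hs]; field_simp
    have hak : a ^ (k + 1) = ε := by
      rw [ha, ← Real.rpow_natCast, ← Real.rpow_mul hε]
      push_cast
      rw [hsk, Real.rpow_one]
    have hbk : b ^ (k + 1) = H := by
      rw [hb, ← Real.rpow_natCast, ← Real.rpow_mul hH0.le]
      push_cast
      rw [hsk, Real.rpow_one]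
    have hbk' : H ^ (1 - s) = b ^ k := by
      rw [hb, ← Real.rpow_natCast, ← Real.rpow_mul hH0.le]
      congr 1
      linarith
    have h1 := h (a / b) (by positivity) ((div_le_one hb0).2 hab)
    rw [div_pow, div_pow, hak, hbk, div_mul_cancel₀ _ hH0.ne'] at h1
    rw [hbk']
    have h2 : a ^ k * L ≤ a ^ k * (2 * Q * a * b ^ k) := by
      have h3 := mul_le_mul_of_nonneg_right h1 (by positivity : 0 ≤ b ^ k)
      have e1 : a ^ k / b ^ k * L * b ^ k = a ^ k * L := by field_simp
      rw [e1] at h3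
      refine h3.trans (le_of_eq ?_)
      rw [← hak]
      ring
    exact le_of_mul_le_mul_left h2 (by positivity)

/-! ### The dual norm and test functions on the enlarged domain -/

theorem normL2_le_ofReal_l2norm {f : E n → ℝ} (hf : MemLp f 2) (S : Set (E n)) :
    normL2 S f ≤ ENNReal.ofReal (l2norm univ f) := by
  have h := eLpNorm_eq_l2norm (S := univ) (f := f) (by simpa using hf)
  rw [← h, Measure.restrict_univ]
  exact eLpNorm_mono_measure f Measure.restrict_le_self

theorem normH2_le {v : E n → ℝ} (hv : ContDiff ℝ ∞ v) (hc : HasCompactSupport v) {R : ℝ}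
    (hR : ∀ x ∈ tsupport v, ‖x‖ ≤ R) (i₀ : Fin n) (Ω : Set (E n)) :
    normH2 Ω v ≤ ENNReal.ofReal (√(1 + 4 * R ^ 2 + 16 * R ^ 4) * l2norm univ (lap v)) := by
  have hsq : ∀ f : E n → ℝ, ContDiff ℝ ∞ f → HasCompactSupport f →
      normL2 Ω f ^ 2 ≤ ENNReal.ofReal (∫ x, f x ^ 2) := by
    intro f hf hfc
    refine (pow_le_pow_left' (normL2_le_ofReal_l2norm
      (hf.continuous.memLp_of_hasCompactSupport hfc) Ω) 2).trans (le_of_eq ?_)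
    rw [← ENNReal.ofReal_pow (l2norm_nonneg _ _), l2norm_sq, Measure.restrict_univ]
  have hp := fun i => contDiff_pd hv i
  have hpc := fun i => hasCompactSupport_pd hc i
  have hnn : ∀ f : E n → ℝ, 0 ≤ ∫ x, f x ^ 2 := fun f => integral_nonneg fun _ => sq_nonneg _
  have hsum : normL2 Ω v ^ 2 + ∑ i, normL2 Ω (pd i v) ^ 2
      + ∑ i, ∑ j, normL2 Ω (pd i (pd j v)) ^ 2
      ≤ ENNReal.ofReal ((1 + 4 * R ^ 2 + 16 * R ^ 4) * ∫ x, lap v x ^ 2) := by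
    refine le_trans ?_ (ENNReal.ofReal_le_ofReal (integral_sobolev_le hv hc hR i₀))
    have n1 : 0 ≤ ∑ i, ∫ x, pd i v x ^ 2 := Finset.sum_nonneg fun i _ => hnn _
    have n2 : ∀ i, 0 ≤ ∑ j, ∫ x, pd i (pd j v) x ^ 2 := fun i => Finset.sum_nonneg fun j _ => hnn _
    rw [ENNReal.ofReal_add (add_nonneg (hnn v) n1) (Finset.sum_nonneg fun i _ => n2 i),
      ENNReal.ofReal_add (hnn v) n1, ENNReal.ofReal_sum_of_nonneg fun i _ => hnn _,
      ENNReal.ofReal_sum_of_nonneg fun i _ => n2 i]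
    refine add_le_add (add_le_add (hsq v hv hc) (Finset.sum_le_sum fun i _ =>
      hsq _ (hp i) (hpc i))) (Finset.sum_le_sum fun i _ => ?_)
    rw [ENNReal.ofReal_sum_of_nonneg fun j _ => hnn _]
    exact Finset.sum_le_sum fun j _ => hsq _ (contDiff_pd (hp j) i) (hasCompactSupport_pd (hpc j) i)
  refine (ENNReal.rpow_le_rpow hsum (by norm_num : (0 : ℝ) ≤ 1 / 2)).trans (le_of_eq ?_)
  rw [ENNReal.ofReal_rpow_of_nonneg (mul_nonneg (by positivity) (hnn _)) (by norm_num),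
    ← Real.sqrt_eq_rpow, Real.sqrt_mul (by positivity), l2norm, Measure.restrict_univ]

/-- The supremum skips functions of zero norm, but for these the second derivatives vanish a.e. on
$\Omega$, and with them $(Bz)(v)$. -/
theorem abs_B_le {Ω S : Set (E n)} (z : E n → ℝ) {v : E n → ℝ}
    (hv : ContDiff ℝ ∞ v) (hmem : v ∈ testSpace Ω S) :
    ‖B Ω z v‖ₑ ≤ dualNormB Ω S z * normH2 Ω v := by
  by_cases h0 : normH2 Ω v = 0
  · have h1 : ∀ i, pd i (pd i v) =ᵐ[volume.restrict Ω] 0 := by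
      intro i
      rw [normH2, ENNReal.rpow_eq_zero_iff_of_pos (by norm_num)] at h0
      have h2 := (add_eq_zero.1 h0).2
      rw [Finset.sum_eq_zero_iff] at h2
      have h3 := h2 i (Finset.mem_univ i)
      rw [Finset.sum_eq_zero_iff] at h3
      have h4 := pow_eq_zero_iff (two_ne_zero) |>.1 (h3 i (Finset.mem_univ i))
      exact (eLpNorm_eq_zero_iff
        (contDiff_pd (contDiff_pd hv i) i).continuous.aestronglyMeasurable (by norm_num)).1 h4
    have h2 : B Ω z v = 0 := by
      rw [B, neg_eq_zero]
      refine integral_eq_zero_of_ae ?_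
      filter_upwards [ae_all_iff.2 h1] with x hx
      rw [laplacian_eq_lap hv]
      simp [lap, hx]
    simp [h2]
  · have h1 : ‖B Ω z v‖ₑ / normH2 Ω v ≤ dualNormB Ω S z :=
      le_iSup₂_of_le (f := fun v (_ : v ∈ testSpace Ω S) =>
        ⨆ _ : normH2 Ω v ≠ 0, ‖B Ω z v‖ₑ / normH2 Ω v) v hmem (le_iSup_of_le h0 le_rfl)
    exact (ENNReal.div_le_iff h0 hmem.2.1.ne).1 h1

theorem mem_testSpace {Ω S W : Set (E n)} (hW : Disjoint W (boundaryCompl Ω S)) {v : E n → ℝ}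
    (hv : ContDiff ℝ ∞ v) (hvs : tsupport v ⊆ W) (hfin : normH2 Ω v < ⊤) : v ∈ testSpace Ω S := by
  refine ⟨hv.contDiffOn, hfin, ?_⟩
  rw [← disjoint_iff_inter_eq_empty]
  exact hW.mono_left ((closure_mono fun x hx => hx.2).trans hvs)

/-! ### Geometry of the boundary and of the enlarged domain -/

/-- Next to a Lipschitz boundary point there are balls that do not meet the domain. -/
theorem IsLipschitzNear.exists_ball_disjoint {Ω : Set (E n)} (hΩ : IsOpen Ω) {x : E n}
    (h : IsLipschitzNear Ω x) {δ : ℝ} (hδ : 0 < δ) :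
    ∃ b : E n, ∃ r : ℝ, 0 < r ∧ Metric.ball b r ⊆ Metric.ball x δ ∧
      Disjoint (Metric.ball b r) Ω := by
  obtain ⟨e, he, K, φ, hφ, ρ, hρ, hx, hgraph⟩ := h
  set P := (Submodule.span ℝ {e})ᗮ.orthogonalProjectionOnto with hP
  have hxΩ : x ∉ Ω := fun hxΩ => by
    rw [frontier, hΩ.interior_eq] at hx
    exact hx.2 hxΩ
  have hx1 : inner ℝ e x ≤ φ (P x) := by
    by_contra hlt
    exact hxΩ ((hgraph x (Metric.mem_ball_self hρ)).2 (not_le.1 hlt))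
  set t : ℝ := min δ ρ / 2 with ht
  have ht0 : 0 < t := by positivity
  set b := x - t • e with hb
  have hPb : P b = P x := by
    have : P e = 0 := Submodule.orthogonalProjectionOnto_apply_of_mem_orthogonal
      (Submodule.le_orthogonal_orthogonal _ (Submodule.mem_span_singleton_self e))
    rw [hb, map_sub, map_smul, this, smul_zero, sub_zero]
  have hib : inner ℝ e b < φ (P b) := by
    rw [hPb, hb, inner_sub_right, inner_smul_right, real_inner_self_eq_norm_sq, he]
    linarith
  have hopen : IsOpen ({y | inner ℝ e y < φ (P y)} ∩ (Metric.ball x ρ ∩ Metric.ball x δ)) := by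
    refine (isOpen_lt (by fun_prop) ?_).inter (Metric.isOpen_ball.inter Metric.isOpen_ball)
    exact hφ.continuous.comp P.continuous
  have hdist : dist b x = t := by
    rw [hb, dist_eq_norm, sub_sub_cancel_left, norm_neg, norm_smul, he, mul_one, Real.norm_eq_abs,
      abs_of_pos ht0]
  obtain ⟨r, hr, hsub⟩ := Metric.isOpen_iff.1 hopen b ⟨hib, by
    rw [Metric.mem_ball, hdist]; linarith [min_le_right δ ρ], by
    rw [Metric.mem_ball, hdist]; linarith [min_le_left δ ρ]⟩
  refine ⟨b, r, hr, fun y hy => (hsub hy).2.2, ?_⟩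
  rw [disjoint_left]
  intro y hy hyΩ
  have h1 := hsub hy
  exact absurd ((hgraph y h1.2.1).1 hyΩ) (not_lt.2 (le_of_lt h1.1))

theorem IsOpenLipschitzBoundaryPart.exists_ball_disjoint_boundaryCompl {Ω S : Set (E n)}
    (h : IsOpenLipschitzBoundaryPart Ω S) {x : E n} (hx : x ∈ S) :
    ∃ δ : ℝ, 0 < δ ∧ Disjoint (Metric.ball x δ) (boundaryCompl Ω S) := by
  obtain ⟨V, hV, hS⟩ := h.relOpen
  rw [hS] at hx
  obtain ⟨δ, hδ, hsub⟩ := Metric.isOpen_iff.1 hV x hx.1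
  refine ⟨δ, hδ, ?_⟩
  rw [disjoint_left]
  intro y hy hy'
  exact hy'.2 (subset_closure (hS ▸ ⟨hsub hy, hy'.1⟩))

/-- Each ball around a point of $\overline\Omega$ meets $\Omega$, so the set is a union of connected
sets that all contain $\Omega$. -/
theorem isPreconnected_union_thickening {Ω P : Set (E n)} (hΩ : IsConnected Ω)
    (hP : P ⊆ closure Ω) {δ : ℝ} (hδ : 0 < δ) : IsPreconnected (Ω ∪ Metric.thickening δ P) := by
  obtain ⟨x₀, hx₀⟩ := hΩ.nonempty
  have h : Ω ∪ Metric.thickening δ P = ⋃₀ ({Ω} ∪ (fun p => Ω ∪ Metric.ball p δ) '' P) := by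
    ext x
    simp only [Metric.thickening_eq_biUnion_ball, mem_union, mem_iUnion, mem_sUnion, mem_image,
      mem_singleton_iff]
    constructor
    · rintro (hx | ⟨p, hp, hx⟩)
      · exact ⟨Ω, Or.inl rfl, hx⟩
      · exact ⟨_, Or.inr ⟨p, hp, rfl⟩, Or.inr hx⟩
    · rintro ⟨_, rfl | ⟨p, hp, rfl⟩, hx⟩
      · exact Or.inl hx
      · exact hx.imp id fun hx => ⟨p, hp, hx⟩
  rw [h]
  refine isPreconnected_sUnion x₀ _ ?_ ?_
  · rintro _ (rfl | ⟨p, hp, rfl⟩)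
    · exact hx₀
    · exact Or.inl hx₀
  · rintro _ (rfl | ⟨p, hp, rfl⟩)
    · exact hΩ.isPreconnected
    · obtain ⟨y, hy, hpy⟩ := Metric.mem_closure_iff.1 (hP hp) δ hδ
      exact IsPreconnected.union' ⟨y, hy, by rwa [Metric.mem_ball, dist_comm]⟩
        hΩ.isPreconnected (convex_ball p δ).isPreconnected

/-! ### Assembly of the stability estimate -/

theorem l2norm_le_add {f g : E n → ℝ} (hf : MemLp f 2) (hg : MemLp g 2) (S : Set (E n)) :
    l2norm S (f + g) ≤ l2norm S f + l2norm S g := by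
  have h := eLpNorm_add_le (hf.restrict S).1 (hg.restrict S).1 one_le_two
  rw [eLpNorm_eq_l2norm ((hf.add hg).restrict S), eLpNorm_eq_l2norm (hf.restrict S),
    eLpNorm_eq_l2norm (hg.restrict S), ← ENNReal.ofReal_add (l2norm_nonneg _ _) (l2norm_nonneg _ _)]
    at h
  exact (ENNReal.ofReal_le_ofReal_iff (add_nonneg (l2norm_nonneg _ _) (l2norm_nonneg _ _))).1 h

theorem l2norm_neg (S : Set (E n)) (f : E n → ℝ) : l2norm S (-f) = l2norm S f := by
  simp [l2norm]

/-- The `H²`-dual bound on the distributional Laplacian of `z`, extended by zero, in terms of the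
`L₂`-norms of the Laplacians of the test functions. -/
theorem abs_integral_indicator_mul_lap_le {Ω S W : Set (E n)} (hΩ : IsOpen Ω)
    (hW : Disjoint W (boundaryCompl Ω S)) {R : ℝ} (hR : ∀ x ∈ W, ‖x‖ ≤ R) (i₀ : Fin n)
    {z : E n → ℝ} (hN : dualNormB Ω S z ≠ ⊤) {v : E n → ℝ} (hv : ContDiff ℝ ∞ v)
    (hc : HasCompactSupport v) (hvs : tsupport v ⊆ W) :
    |∫ x, Ω.indicator z x * lap v x|
      ≤ √(1 + 4 * R ^ 2 + 16 * R ^ 4) * (dualNormB Ω S z).toReal * l2norm univ (lap v) := by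
  have hH := normH2_le hv hc (fun x hx => hR x (hvs hx)) i₀ Ω
  have hmem := mem_testSpace hW hv hvs (hH.trans_lt ENNReal.ofReal_lt_top)
  have hB : ∫ x, Ω.indicator z x * lap v x = -B Ω z v := by
    rw [B, neg_neg, laplacian_eq_lap hv, ← integral_indicator hΩ.measurableSet]
    congr 1
    ext x
    by_cases hx : x ∈ Ω <;> simp [hx]
  have h1 := (abs_B_le z hv hmem).trans (mul_le_mul_right hH _)
  rw [hB, abs_neg, ← Real.norm_eq_abs, ← toReal_enorm]
  have h2 := ENNReal.toReal_mono (ENNReal.mul_ne_top hN ENNReal.ofReal_ne_top) h1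
  rw [ENNReal.toReal_mul, ENNReal.toReal_ofReal
    (mul_nonneg (Real.sqrt_nonneg _) (l2norm_nonneg _ _))] at h2
  linarith

/-- The conditional stability estimate in terms of an interpolation parameter `t`. -/
theorem exists_interpolated_stability {Ω S G : Set (E n)} (hΩo : IsOpen Ω) (hΩc : IsConnected Ω)
    (hΩb : Bornology.IsBounded Ω) (hS : IsOpenLipschitzBoundaryPart Ω S) (hSn : S.Nonempty)
    (hGΩ : G ⊆ Ω)
    (hGS : ∃ d : ℝ, 0 < d ∧ ∀ x ∈ G, ∀ y ∈ boundaryCompl Ω S, d ≤ dist x y) :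
    ∃ k : ℕ, ∃ Q : ℝ, 0 < Q ∧ ∀ z : E n → ℝ, MemLp z 2 (volume.restrict Ω) →
      dualNormB Ω S z ≠ ⊤ → ∀ t : ℝ, 0 < t → t ≤ 1 →
        t ^ (k + 1) * l2norm G z ≤ Q * ((dualNormB Ω S z).toReal +
          t ^ (k + 2) * (l2norm Ω z + (dualNormB Ω S z).toReal)) := by
  obtain ⟨x₀, hx₀⟩ := hSn
  obtain ⟨d, hd, hdG⟩ := hGS
  obtain ⟨d₀, hd₀, hdisj₀⟩ := hS.exists_ball_disjoint_boundaryCompl hx₀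
  have hlip := hS.lipschitz x₀ hx₀
  -- The unit vector in the Lipschitz condition rules out $n=0$; the Poincaré inequality needs a
  -- coordinate direction.
  obtain ⟨i₀⟩ : Nonempty (Fin n) := by
    obtain ⟨e, he, -⟩ := hlip
    by_contra hne
    rw [not_nonempty_iff] at hne
    rw [Subsingleton.elim e 0, norm_zero] at he
    exact zero_ne_one he
  have hx₀f : x₀ ∈ frontier Ω := by
    obtain ⟨V, -, hV⟩ := hS.relOpen
    rw [hV] at hx₀
    exact hx₀.2
  set δ := min d d₀ with hδ
  have hδ0 : 0 < δ := by positivity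
  obtain ⟨b, rb, hrb, hbsub, hbΩ⟩ := hlip.exists_ball_disjoint hΩo hδ0
  -- Thickening at $x_0$ reaches the exterior ball. Thickening $G$ puts $\overline G$ inside $W$,
  -- even where $G$ touches the boundary.
  set W := Ω ∪ Metric.thickening δ (insert x₀ G) with hWdef
  have hWo : IsOpen W := hΩo.union Metric.isOpen_thickening
  have hWc : IsPreconnected W := isPreconnected_union_thickening hΩc
    (insert_subset (frontier_subset_closure hx₀f) (hGΩ.trans subset_closure)) hδ0
  have hWb : Bornology.IsBounded W :=
    hΩb.union (((hΩb.subset hGΩ).insert x₀).thickening)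
  have hWdisj : Disjoint W (boundaryCompl Ω S) := by
    rw [disjoint_left]
    rintro y (hy | hy) hy'
    · have := hy'.1
      rw [frontier, hΩo.interior_eq] at this
      exact this.2 hy
    · obtain ⟨p, rfl | hp, hyp⟩ := Metric.mem_thickening_iff.1 hy
      · exact disjoint_left.1 hdisj₀ (hyp.trans_le (min_le_right _ _)) hy'
      · have := hdG p hp y hy'
        rw [dist_comm] at this
        linarith [min_le_left d d₀]
  obtain ⟨R, hR⟩ := hWb.exists_norm_le
  have hGW : closure G ⊆ W := by
    intro y hy
    obtain ⟨p, hp, hyp⟩ := Metric.mem_closure_iff.1 hy δ hδ0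
    exact Or.inr (Metric.mem_thickening_iff.2 ⟨p, Or.inr hp, hyp⟩)
  have hbW : b ∈ W := Or.inr (Metric.mem_thickening_iff.2
    ⟨x₀, Or.inl rfl, hbsub (Metric.mem_ball_self hrb)⟩)
  obtain ⟨k, C, A, hC, hA, hctrl⟩ := exists_controls_isCompact hWo hWc hrb hbW
    (hΩb.subset hGΩ).isCompact_closure hGW
  -- Raising the exponent to at least $1$ ensures that the final Hölder exponent $1/(k+2)$ is less
  -- than $1$.
  replace hctrl := (hctrl.mono subset_closure).raise hC 1
  set c := √(1 + 4 * R ^ 2 + 16 * R ^ 4) with hcdef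
  have hc : 0 < c := Real.sqrt_pos.2 (by positivity)
  refine ⟨k, (C + 1) * c + A * (1 + c), by positivity, fun z hz hN t ht ht1 => ?_⟩
  set ε := (dualNormB Ω S z).toReal
  have hε : 0 ≤ ε := ENNReal.toReal_nonneg
  have hz' : MemLp (Ω.indicator z) 2 := (memLp_indicator_iff_restrict hΩo.measurableSet).2 hz
  obtain ⟨w, hw, hwn, hharm⟩ := exists_weaklyHarmonic_decomposition hz' (by positivity : 0 ≤ c * ε)
    fun v hv hvc hvs => abs_integral_indicator_mul_lap_le hΩo hWdisj hR i₀ hN hv hvc hvs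
  set h := Ω.indicator z - w with hh
  have hhm : MemLp h 2 := hz'.sub hw
  -- The extension of $z$ vanishes on the exterior ball, so $h=-w$ there.
  have hball : l2norm (Metric.ball b rb) h ≤ c * ε := by
    refine le_trans (le_of_eq ?_) ((l2norm_mono hw (subset_univ (Metric.ball b rb))).trans hwn)
    unfold l2norm
    congr 1
    refine setIntegral_congr_fun Metric.isOpen_ball.measurableSet fun x hx => ?_
    simp [hh, disjoint_left.1 hbΩ hx]
  have hZ : l2norm univ (Ω.indicator z) = l2norm Ω z := by
    unfold l2norm
    congr 1
    rw [Measure.restrict_univ, ← integral_indicator hΩo.measurableSet]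
    congr 1
    ext x
    by_cases hx : x ∈ Ω <;> simp [hx]
  have huniv : l2norm univ h ≤ l2norm Ω z + c * ε := by
    have := l2norm_le_add hz' hw.neg univ
    rw [l2norm_neg, hZ, ← sub_eq_add_neg] at this
    linarith
  have hG : l2norm G z ≤ l2norm G h + c * ε := by
    have h1 := l2norm_le_add hhm hw G
    rw [hh, sub_add_cancel] at h1
    have h2 : l2norm G (Ω.indicator z) = l2norm G z := by
      unfold l2norm
      congr 1
      have hr : ((volume : Measure (E n)).restrict Ω).restrict G = volume.restrict G :=
        Measure.restrict_restrict_of_subset hGΩ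
      refine integral_congr_ae ?_
      rw [← hr]
      refine ae_restrict_of_ae ((ae_restrict_mem hΩo.measurableSet).mono fun x hx => ?_)
      simp [hx]
    rw [h2] at h1
    linarith [l2norm_mono hw (subset_univ G)]
  have h1 := hctrl h hhm hharm t ht ht1
  have hZ0 := l2norm_nonneg Ω z
  have ht2 : t ^ (k + 1) * (c * ε) ≤ 1 * (c * ε) :=
    mul_le_mul_of_nonneg_right (pow_le_one₀ ht.le ht1) (by positivity)
  calc t ^ (k + 1) * l2norm G z ≤ t ^ (k + 1) * (l2norm G h + c * ε) := by gcongr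
    _ = t ^ (k + 1) * l2norm G h + t ^ (k + 1) * (c * ε) := by ring
    _ ≤ (C * (c * ε) + A * t ^ (k + 2) * (l2norm Ω z + c * ε)) + 1 * (c * ε) := by
        refine add_le_add (h1.trans ?_) ht2
        gcongr
    _ ≤ _ := by
        have e1 : 0 ≤ A * (1 + c) * ε := by positivity
        have e2 : 0 ≤ t ^ (k + 2) := by positivity
        have e3 : 0 ≤ t ^ (k + 2) * ((C + 1) * c * (l2norm Ω z + ε)) := by positivity
        have e4 : 0 ≤ t ^ (k + 2) * (A * (ε + c * l2norm Ω z)) := by positivity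
        nlinarith

end CauchyStability

end

theorem theorem2p4 (n : ℕ) (Ω S G : Set (CauchyStability.E n))
    (hΩo : IsOpen Ω) (hΩc : IsConnected Ω) (hΩb : Bornology.IsBounded Ω)
    (hS : CauchyStability.IsOpenLipschitzBoundaryPart Ω S) (hSc : IsConnected S)
    (hGo : IsOpen G) (hGc : IsConnected G) (hGΩ : G ⊆ Ω)
    (hGS : ∃ d : ℝ, 0 < d ∧ ∀ x ∈ G, ∀ y ∈ CauchyStability.boundaryCompl Ω S, d ≤ dist x y) :
    ∃ α : ℝ, 0 < α ∧ α < 1 ∧ ∃ C : ℝ≥0, ∀ z : CauchyStability.E n → ℝ,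
      MemLp z 2 (volume.restrict Ω) →
        CauchyStability.normL2 G z ≤
          C * CauchyStability.dualNormB Ω S z ^ α *
            (CauchyStability.normL2 Ω z + CauchyStability.dualNormB Ω S z) ^ (1 - α) := by
  obtain ⟨k, Q, hQ, hmain⟩ := CauchyStability.exists_interpolated_stability hΩo hΩc hΩb hS
    hSc.nonempty hGΩ hGS
  have hk : (0 : ℝ) < ((k + 1 : ℕ) : ℝ) := by positivity
  set α : ℝ := 1 / (((k + 1 : ℕ) : ℝ) + 1) with hα
  have hα0 : 0 < α := by positivity
  have hα1 : α < 1 := by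
    rw [hα, div_lt_one (by positivity)]
    linarith
  refine ⟨α, hα0, hα1, (2 * Q).toNNReal, fun z hz => ?_⟩
  have hC : ((2 * Q).toNNReal : ℝ≥0∞) = ENNReal.ofReal (2 * Q) := rfl
  -- An infinite dual norm makes the right side `⊤`, as both exponents and the constant are
  -- positive; finiteness therefore needs no proof.
  by_cases hN : CauchyStability.dualNormB Ω S z = ⊤
  · have hC0 : ENNReal.ofReal (2 * Q) ≠ 0 := (ENNReal.ofReal_pos.2 (by positivity)).ne'
    rw [hN, hC, add_top, ENNReal.top_rpow_of_pos hα0, ENNReal.top_rpow_of_pos (sub_pos.2 hα1),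
      ENNReal.mul_top hC0, ENNReal.top_mul_top]
    exact le_top
  · have hzG : MemLp z 2 (volume.restrict G) := hz.mono_measure (Measure.restrict_mono hGΩ le_rfl)
    set ε := (CauchyStability.dualNormB Ω S z).toReal with hε
    have hε0 : 0 ≤ ε := ENNReal.toReal_nonneg
    have hZ0 := CauchyStability.l2norm_nonneg Ω z
    have h1 := CauchyStability.le_rpow_of_forall_interpolation (k := k + 1)
      (L := CauchyStability.l2norm G z) (H := CauchyStability.l2norm Ω z + ε) hε0
      (by linarith) (hmain z hz hN)
    rw [CauchyStability.normL2, CauchyStability.eLpNorm_eq_l2norm hzG, CauchyStability.normL2,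
      CauchyStability.eLpNorm_eq_l2norm hz, hC, ← ENNReal.ofReal_toReal hN, ← hε,
      ← ENNReal.ofReal_add hZ0 hε0, ENNReal.ofReal_rpow_of_nonneg hε0 hα0.le,
      ENNReal.ofReal_rpow_of_nonneg (by positivity) (sub_nonneg.2 hα1.le),
      ← ENNReal.ofReal_mul (by positivity), ← ENNReal.ofReal_mul (by positivity)]
    exact ENNReal.ofReal_le_ofReal h1
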